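/- Let $N\ge 2$ be an integer and $E^+>0$. There is a constant $C>0$, depending only on $N$ and $E^+$, such that the following holds. Let $\mathcal H$ be a complex Hilbert space (of arbitrary dimension), $\rho$ a density operator on $\mathcal H$ (positive, $\operatorname{tr}\rho=1$), $H$ a self-adjoint operator on $\mathcal H$ with $\operatorname{spec}(H)\subseteq[0,E^+]$, and $(M_0,M_1)$ a two-outcome POVM on $\mathcal H$ (that is, $M_0,M_1\ge 0$ and $M_0+M_1=\mathbb I$). Put $$P(a|t)=\operatorname{tr}\!\left(e^{-iHt}\rho\, e^{iHt}M_a\right),\qquad t_j=\frac{2\pi(N-1)j}{N E^+},\quad j=0,\dots,N-1,$$ and let $\mathbf D_N$ be the dataset with $\mathbf D_N(0|t_0)=1$, $\mathbf D_N(0|t_j)=0$ for $j=1,\dots,N-1$, and $\mathbf D_N(1|t_j)=1-\mathbf D_N(0|t_j)$. Suppose that, for some real number $\delta$, $$\sum_{a\in\{0,1\}}\left|P(a|t_j)-\mathbf D_N(a|t_j)\right|\le\delta\qquad\text{for } j=0,\dots,N-1 .$$ On $\mathbb C^N$ with standard basis $|0\rangle,\dots,|N-1\rangle$ define $$\bar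 H=\frac{E^+}{N-1}\sum_{k=0}^{N-1}k\,|k\rangle\langle k|,\quad |\bar\psi\rangle=\frac1{\sqrt N}\sum_{k=0}^{N-1}|k\rangle,\quad \bar M_0=|\bar\psi\rangle\langle\bar\psi|,\quad \bar M_1=\mathbb I-|\bar\psi\rangle\langle\bar\psi| .$$ Then there exist a Hilbert space $K$, a linear isometry $V:\mathcal H\to\mathbb C^N\otimes K$ and a density operator $\gamma$ on $K$ such that, for all $t\in\mathbb R$ and $a\in\{0,1\}$, $$\left\|V M_a e^{-iHt}\rho\, e^{iHt}V^\dagger-\left(\bar M_a e^{-i\bar Ht}|\bar\psi\rangle\langle\bar\psi|e^{i\bar Ht}\right)\otimes\gamma\right\|_1\le C\,\delta^{1/64}+C\,\delta^{1/8}|t| ,$$ where $\|X\|_1=\operatorname{tr}\sqrt{X^\dagger X}$ is the trace norm. -/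

import Mathlib

universe u v

open scoped TensorProduct InnerProductSpace

noncomputable section

namespace SelfTest

/-! ### Trace and trace norm of operators on a Hilbert space -/

section Operators

variable (E : Type u) [NormedAddCommGroup E] [InnerProductSpace ℂ E] [CompleteSpace E]

/-- Index set of a fixed orthonormal (Hilbert) basis of `E`. -/
def basisIndex : Set E := (exists_hilbertBasis ℂ E).choose

/-- A fixed orthonormal (Hilbert) basis of `E`. The trace of a trace-class operator and the trace
norm of any operator do not depend on this choice. -/
def onb : HilbertBasis (basisIndex E) ℂ E := (exists_hilbertBasis ℂ E).choose_spec.choose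

variable {E}

/-- The trace `∑ᵢ ⟨eᵢ, T eᵢ⟩`; meaningful for trace-class `T`. -/
def trace (T : E →L[ℂ] E) : ℂ := ∑' i, ⟪onb E i, T (onb E i)⟫_ℂ

/-- The trace norm `‖T‖₁ = tr |T|` with `|T| = √(T† T)`; it is `∞` iff `T` is not trace class. -/
def traceNorm (T : E →L[ℂ] E) : ENNReal :=
  ∑' i, ENNReal.ofReal (⟪onb E i, CFC.abs T (onb E i)⟫_ℂ).re

/-- Normalized quantum states: positive operators of trace one. (If the defining series of the trace
did not converge, `trace ρ` would be `0`; so the second condition includes convergence.) -/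
def IsDensityOperator (ρ : E →L[ℂ] E) : Prop := ρ.IsPositive ∧ trace ρ = 1

/-- Schrödinger evolution `e^{-iHt} ρ e^{iHt}`. -/
def evolve (H ρ : E →L[ℂ] E) (t : ℝ) : E →L[ℂ] E :=
  NormedSpace.exp ((-(Complex.I * (t : ℂ))) • H) * ρ * NormedSpace.exp ((Complex.I * (t : ℂ)) • H)

/-- The projector `|ψ⟩⟨ψ|` (for a unit vector `ψ`). -/
def proj (ψ : E) : E →L[ℂ] E := InnerProductSpace.rankOne ℂ ψ ψ

end Operators

/-! ### Realizations of timelines -/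

/-- A realization `(𝓗, ρ, H, M)` of a timeline of a single measurement with outcomes in `A`.
The Hamiltonian is bounded, since only Hamiltonians with spectrum in `[0, E⁺]` are considered. -/
structure Realization (𝓗 : Type u) [NormedAddCommGroup 𝓗] [InnerProductSpace ℂ 𝓗]
    [CompleteSpace 𝓗] (A : Type v) [Fintype A] where
  /-- the initial state -/
  state : 𝓗 →L[ℂ] 𝓗
  /-- the Hamiltonian -/
  hamiltonian : 𝓗 →L[ℂ] 𝓗
  /-- the POVM elements -/
  meas : A → (𝓗 →L[ℂ] 𝓗)
  isDensityOperator_state : IsDensityOperator state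
  isSelfAdjoint_hamiltonian : IsSelfAdjoint hamiltonian
  isPositive_meas : ∀ a, (meas a).IsPositive
  sum_meas : ∑ a, meas a = 1

namespace Realization

variable {𝓗 : Type u} [NormedAddCommGroup 𝓗] [InnerProductSpace ℂ 𝓗] [CompleteSpace 𝓗]
  {A : Type v} [Fintype A]

/-- The timeline `P(a|t) = tr(e^{-iHt} ρ e^{iHt} M_a)` (which is a real number). -/
def timeline (R : Realization 𝓗 A) (a : A) (t : ℝ) : ℝ :=
  (trace (evolve R.hamiltonian R.state t * R.meas a)).re

/-- The hard support constraint `spec(H) ⊆ [0, E⁺]`. -/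
def HardSupport (R : Realization 𝓗 A) (Eplus : ℝ) : Prop :=
  spectrum ℝ R.hamiltonian ⊆ Set.Icc 0 Eplus

end Realization

/-! ### The dataset `D_N` -/

/-- The times `t_j = 2π(N-1)j / (N E⁺)`. -/
def dataTime (N : ℕ) (Eplus : ℝ) (j : Fin N) : ℝ :=
  2 * Real.pi * ((N : ℝ) - 1) * ((j : ℕ) : ℝ) / ((N : ℝ) * Eplus)

/-- The dataset `D_N`: at `t_0` the first outcome (here `0`) is certain; at `t_1, …, t_{N-1}` the
second outcome (here `1`) is certain. -/
def dataset (N : ℕ) (a : Fin 2) (j : Fin N) : ℝ :=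
  if (j : ℕ) = 0 then (if a = 0 then 1 else 0) else (if a = 0 then 0 else 1)

/-- The timeline `P` fits `D_N` up to error `δ`. -/
def Fits (N : ℕ) (Eplus δ : ℝ) (P : Fin 2 → ℝ → ℝ) : Prop :=
  ∀ j : Fin N, ∑ a, |P a (dataTime N Eplus j) - dataset N a j| ≤ δ

/-! ### The reference realization on `ℂ^N` -/

/-- `H̄ = E⁺/(N-1) ∑ₖ k |k⟩⟨k|`. -/
def refHamiltonian (N : ℕ) (Eplus : ℝ) : EuclideanSpace ℂ (Fin N) →L[ℂ] EuclideanSpace ℂ (Fin N) :=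
  ((Eplus / ((N : ℝ) - 1) : ℝ) : ℂ) •
    ∑ k : Fin N, ((k : ℕ) : ℂ) • proj (EuclideanSpace.single k (1 : ℂ))

/-- `|ψ̄⟩ = N^{-1/2} ∑ₖ |k⟩`. -/
def refVector (N : ℕ) : EuclideanSpace ℂ (Fin N) :=
  (((Real.sqrt N)⁻¹ : ℝ) : ℂ) • ∑ k : Fin N, EuclideanSpace.single k (1 : ℂ)

/-- The projective measurement `(|ψ̄⟩⟨ψ̄|, 𝟙 - |ψ̄⟩⟨ψ̄|)`. -/
def refMeas (N : ℕ) : Fin 2 → (EuclideanSpace ℂ (Fin N) →L[ℂ] EuclideanSpace ℂ (Fin N)) :=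
  ![proj (refVector N), 1 - proj (refVector N)]

/-! ### The Hilbert space `ℂ^N ⊗ K` -/

section Tensor

variable (N : ℕ) (K : Type u) [NormedAddCommGroup K] [InnerProductSpace ℂ K]

/-- The map `K^N → ℂ^N ⊗ K`, `x ↦ ∑ₖ |k⟩ ⊗ xₖ`. -/
def sumTmul : PiLp 2 (fun _ : Fin N => K) →ₗ[ℂ] EuclideanSpace ℂ (Fin N) ⊗[ℂ] K where
  toFun x := ∑ k, EuclideanSpace.single k (1 : ℂ) ⊗ₜ[ℂ] x k
  map_add' x y := by simp [TensorProduct.tmul_add, Finset.sum_add_distrib]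
  map_smul' c x := by simp [Finset.smul_sum]

theorem inner_sumTmul (x y : PiLp 2 (fun _ : Fin N => K)) :
    ⟪sumTmul N K x, sumTmul N K y⟫_ℂ = ⟪x, y⟫_ℂ := by
  simp [sumTmul, sum_inner, inner_sum, PiLp.inner_apply]

theorem sumTmul_surjective : Function.Surjective (sumTmul N K) := by
  intro z
  induction z using TensorProduct.induction_on with
  | zero => exact ⟨0, map_zero _⟩
  | tmul v w =>
    refine ⟨WithLp.toLp 2 (fun k => v k • w), ?_⟩
    have h : v = ∑ k, v k • EuclideanSpace.single k (1 : ℂ) := by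
      ext j
      simp [Pi.single_apply]
    conv_rhs => rw [h, TensorProduct.sum_tmul]
    simp [sumTmul, TensorProduct.smul_tmul]
  | add a b ha hb =>
    obtain ⟨x, rfl⟩ := ha
    obtain ⟨y, rfl⟩ := hb
    exact ⟨x + y, map_add _ _ _⟩

/-- Since `ℂ^N` is finite-dimensional, the algebraic tensor product is already complete. -/
instance instCompleteSpaceTensor [CompleteSpace K] :
    CompleteSpace (EuclideanSpace ℂ (Fin N) ⊗[ℂ] K) := by
  let e : PiLp 2 (fun _ : Fin N => K) ≃ₗᵢ[ℂ] EuclideanSpace ℂ (Fin N) ⊗[ℂ] K :=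
    LinearIsometryEquiv.ofSurjective
      ((sumTmul N K).isometryOfInner (inner_sumTmul N K)) (sumTmul_surjective N K)
  exact (completeSpace_congr (e := e.toEquiv) e.isometry.isUniformEmbedding).1 inferInstance

end Tensor

/-- `V X V†` for an isometry `V`. -/
def conjIsometry {E : Type u} {F : Type v} [NormedAddCommGroup E] [InnerProductSpace ℂ E]
    [CompleteSpace E] [NormedAddCommGroup F] [InnerProductSpace ℂ F] [CompleteSpace F]
    (V : E →ₗᵢ[ℂ] F) (X : E →L[ℂ] E) : F →L[ℂ] F :=
  V.toContinuousLinearMap ∘L X ∘L ContinuousLinearMap.adjoint V.toContinuousLinearMap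

end SelfTest

end

/-!
Purifying `ρ` to the family `w = (√ρ eᵢ)ᵢ`, expectation values become inner products of vectors
`amp w X = (X √ρ eᵢ)ᵢ`, and two families at distance `ε` have marginals at trace distance `O(ε)`.

Let `τ` be the spacing of the times `t_j` and `U = e^{-iHτ}`. The data say that `M₀` accepts `w` and
rejects `U w, …, U^{N-1} w`, up to errors `√δ`. As `spec(H τ) ⊆ [0, 2π - 2π/N]` leaves a spectral
gap, a nonnegativity estimate for a sine-weighted cosine polynomial turns the nearly vanishing
moments `⟨w, U^j w⟩` into `U^N w ≈ w`, with error `O(δ^{1/4})`. So `w` is nearly a sum of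
eigenvectors `P_k w` of `U`, where `P_k` is the average of the powers of `e^{2πik/N} U`; the
spectral gap also pins down the energies, so that `e^{-iHt} P_k w ≈ e^{-itE_k} P_k w` up to
`O(|t| δ^{1/4})`.

Finally `M₀ P_k w ≈ w / N`, so `√N ∑ₖ |k⟩ ⊗ M₀ P_k` is an approximate isometry on these vectors that
carries `P_k w` to `|k⟩ ⊗ w / √N`; a Cayley transform dilates it to an isometry.
-/

noncomputable section

namespace SelfTest

open ContinuousLinearMap

/-! ### Hilbert–Schmidt sums and the trace norm -/

section HilbertSchmidt

variable {ι κ E F G : Type*} [NormedAddCommGroup E] [InnerProductSpace ℂ E]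
  [NormedAddCommGroup F] [InnerProductSpace ℂ F] [NormedAddCommGroup G] [InnerProductSpace ℂ G]

/-- The squared Hilbert–Schmidt norm `∑ᵢ ‖A bᵢ‖²`, which does not depend on the Hilbert basis `b`;
it is `∞` iff `A` is not Hilbert–Schmidt. -/
def hsSq (b : HilbertBasis ι ℂ E) (A : E →L[ℂ] F) : ENNReal :=
  ∑' i, ENNReal.ofReal (‖A (b i)‖ ^ 2)

theorem hasSum_norm_inner_sq (b : HilbertBasis ι ℂ E) (x : E) :
    HasSum (fun i => ‖⟪b i, x⟫_ℂ‖ ^ 2) (‖x‖ ^ 2) := by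
  convert Complex.hasSum_re (b.hasSum_inner_mul_inner x x) using 1
  · funext i
    rw [← Complex.normSq_eq_norm_sq, ← inner_conj_symm, Complex.mul_conj, Complex.ofReal_re,
      Complex.normSq_conj]
  · exact (inner_self_eq_norm_sq (𝕜 := ℂ) x).symm

theorem ofReal_norm_sq_eq_tsum (b : HilbertBasis ι ℂ E) (x : E) :
    ENNReal.ofReal (‖x‖ ^ 2) = ∑' i, ENNReal.ofReal (‖⟪b i, x⟫_ℂ‖ ^ 2) := by
  have hsum := hasSum_norm_inner_sq b x
  rw [← hsum.tsum_eq, ENNReal.ofReal_tsum_of_nonneg (fun _ => sq_nonneg _) hsum.summable]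

theorem hsSq_comp_le (b : HilbertBasis ι ℂ E) (Y : F →L[ℂ] G) (A : E →L[ℂ] F) :
    hsSq b (Y ∘L A) ≤ ENNReal.ofReal (‖Y‖ ^ 2) * hsSq b A := by
  unfold hsSq
  rw [← ENNReal.tsum_mul_left]
  refine ENNReal.tsum_le_tsum fun i => ?_
  rw [← ENNReal.ofReal_mul (sq_nonneg _), ← mul_pow]
  gcongr
  exact Y.le_opNorm _

theorem summable_of_hsSq_ne_top {b : HilbertBasis ι ℂ E} {A : E →L[ℂ] F}
    (hA : hsSq b A ≠ ⊤) : Summable fun i => ‖A (b i)‖ ^ 2 := by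
  simpa [ENNReal.toReal_ofReal, sq_nonneg] using ENNReal.summable_toReal hA

theorem summable_norm_inner_sq_of_hsSq_ne_top {b : HilbertBasis ι ℂ E} (c : HilbertBasis κ ℂ F)
    {A : E →L[ℂ] F} (hA : hsSq b A ≠ ⊤) :
    Summable fun p : ι × κ => ‖⟪c p.2, A (b p.1)⟫_ℂ‖ ^ 2 := by
  refine (summable_prod_of_nonneg fun _ => sq_nonneg _).2
    ⟨fun j => (hasSum_norm_inner_sq c (A (b j))).summable, ?_⟩
  simpa only [(hasSum_norm_inner_sq c (A (b _))).tsum_eq] using summable_of_hsSq_ne_top hA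

theorem norm_apply_le_norm_apply_add_smul {P : E →L[ℂ] E} (hP : P.IsPositive) {ε : ℝ}
    (hε : 0 ≤ ε) (x : E) : ‖P x‖ ≤ ‖P x + (ε : ℂ) • x‖ := by
  refine le_of_sq_le_sq ?_ (norm_nonneg _)
  have hpos : 0 ≤ ε * (⟪P x, x⟫_ℂ).re := mul_nonneg hε (hP.re_inner_nonneg_left x)
  have hinner : RCLike.re ⟪P x, (ε : ℂ) • x⟫_ℂ = ε * (⟪P x, x⟫_ℂ).re := by
    rw [inner_smul_right]
    exact Complex.re_ofReal_mul _ _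
  rw [norm_add_sq (𝕜 := ℂ), hinner]
  nlinarith [sq_nonneg ‖(ε : ℂ) • x‖]

variable [CompleteSpace E] [CompleteSpace F] [CompleteSpace G]

theorem hsSq_adjoint (b : HilbertBasis ι ℂ E) (c : HilbertBasis κ ℂ F) (A : E →L[ℂ] F) :
    hsSq c (adjoint A) = hsSq b A := by
  unfold hsSq
  simp_rw [ofReal_norm_sq_eq_tsum b (adjoint A _), ofReal_norm_sq_eq_tsum c (A _)]
  rw [ENNReal.tsum_comm]
  refine tsum_congr fun i => tsum_congr fun j => ?_
  rw [adjoint_inner_right, norm_inner_symm]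

theorem trace_comp_adjoint (b : HilbertBasis ι ℂ E) {A B : E →L[ℂ] F}
    (hA : hsSq b A ≠ ⊤) (hB : hsSq b B ≠ ⊤) :
    trace (A ∘L adjoint B) = ∑' j, ⟪B (b j), A (b j)⟫_ℂ := by
  set e := onb F
  have hsum : Summable (Function.uncurry fun (j : ι) (i : basisIndex F) =>
      ⟪B (b j), e i⟫_ℂ * ⟪e i, A (b j)⟫_ℂ) := by
    refine Summable.of_norm_bounded ((summable_norm_inner_sq_of_hsSq_ne_top e hB).add
      (summable_norm_inner_sq_of_hsSq_ne_top e hA)) fun p => ?_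
    rw [Function.uncurry_def, norm_mul, norm_inner_symm]
    nlinarith [two_mul_le_add_sq ‖⟪e p.2, B (b p.1)⟫_ℂ‖ ‖⟪e p.2, A (b p.1)⟫_ℂ‖,
      sq_nonneg ‖⟪e p.2, A (b p.1)⟫_ℂ‖, sq_nonneg ‖⟪e p.2, B (b p.1)⟫_ℂ‖]
  calc trace (A ∘L adjoint B)
      = ∑' i, ∑' j, ⟪B (b j), e i⟫_ℂ * ⟪e i, A (b j)⟫_ℂ := by
        refine tsum_congr fun i => ?_
        rw [comp_apply, ← adjoint_inner_left, ← (b.hasSum_inner_mul_inner _ _).tsum_eq]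
        refine tsum_congr fun j => ?_
        rw [adjoint_inner_left, adjoint_inner_right, mul_comm]
    _ = ∑' j, ∑' i, ⟪B (b j), e i⟫_ℂ * ⟪e i, A (b j)⟫_ℂ := hsum.tsum_comm
    _ = ∑' j, ⟪B (b j), A (b j)⟫_ℂ :=
        tsum_congr fun j => (e.hasSum_inner_mul_inner _ _).tsum_eq

theorem sum_norm_adjoint_sq_le (b : HilbertBasis ι ℂ E) (c : HilbertBasis κ ℂ G)
    {A : E →L[ℂ] F} {α : ℝ} (hA : hsSq b A ≤ ENNReal.ofReal (α ^ 2)) {W : G →L[ℂ] F}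
    (hW : ‖W‖ ≤ 1) (s : Finset κ) : ∑ i ∈ s, ‖adjoint A (W (c i))‖ ^ 2 ≤ α ^ 2 := by
  have hWA : hsSq c (adjoint (adjoint W ∘L A)) ≤ ENNReal.ofReal (α ^ 2) := by
    rw [hsSq_adjoint b]
    refine (hsSq_comp_le b _ A).trans ((mul_le_of_le_one_left' ?_).trans hA)
    rw [ENNReal.ofReal_le_one, LinearIsometryEquiv.norm_map]
    exact pow_le_one₀ (norm_nonneg _) hW
  have hsum := (ENNReal.sum_le_tsum s).trans hWA
  rw [← ENNReal.ofReal_sum_of_nonneg (fun _ _ => sq_nonneg _),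
    ENNReal.ofReal_le_ofReal_iff (sq_nonneg _)] at hsum
  simpa [adjoint_comp] using hsum

theorem sum_re_inner_comp_adjoint_le (b : HilbertBasis ι ℂ E) (c : HilbertBasis κ ℂ F)
    {A B : E →L[ℂ] F} {α β : ℝ} (hα : 0 ≤ α) (hβ : 0 ≤ β)
    (hA : hsSq b A ≤ ENNReal.ofReal (α ^ 2)) (hB : hsSq b B ≤ ENNReal.ofReal (β ^ 2))
    {W : F →L[ℂ] F} (hW : ‖W‖ ≤ 1) (s : Finset κ) :
    ∑ i ∈ s, (⟪W (c i), (A ∘L adjoint B) (c i)⟫_ℂ).re ≤ α * β :=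
  calc ∑ i ∈ s, (⟪W (c i), (A ∘L adjoint B) (c i)⟫_ℂ).re
      ≤ ∑ i ∈ s, ‖adjoint A (W (c i))‖ * ‖adjoint B (c i)‖ := by
        refine Finset.sum_le_sum fun i _ => ?_
        rw [comp_apply, ← adjoint_inner_left]
        exact (Complex.re_le_norm _).trans (norm_inner_le_norm _ _)
    _ ≤ √(∑ i ∈ s, ‖adjoint A (W (c i))‖ ^ 2) * √(∑ i ∈ s, ‖adjoint B (c i)‖ ^ 2) :=
        Real.sum_mul_le_sqrt_mul_sqrt _ _ _
    _ ≤ α * β := by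
        gcongr
        · exact Real.sqrt_le_iff.2 ⟨hα, sum_norm_adjoint_sq_le b c hA hW s⟩
        · exact Real.sqrt_le_iff.2 ⟨hβ, sum_norm_adjoint_sq_le b c hB (W := 1) norm_id_le s⟩

theorem norm_abs_apply (T : E →L[ℂ] E) (x : E) : ‖CFC.abs T x‖ = ‖T x‖ := by
  have habs : adjoint (CFC.abs T) = CFC.abs T := (CFC.abs_nonneg T).isSelfAdjoint
  have hsq : ⟪x, (CFC.abs T * CFC.abs T) x⟫_ℂ = ⟪x, (adjoint T * T) x⟫_ℂ := by
    rw [CFC.abs_mul_abs, star_eq_adjoint]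
  rw [mul_apply_eq_comp, mul_apply_eq_comp, ← adjoint_inner_left, habs, adjoint_inner_right,
    inner_self_eq_norm_sq_to_K, inner_self_eq_norm_sq_to_K] at hsq
  exact (sq_eq_sq₀ (norm_nonneg _) (norm_nonneg _)).1 (by exact_mod_cast hsq)

theorem exists_add_smul_mul_eq_one {P : E →L[ℂ] E} (hP : P.IsPositive) {ε : ℝ} (hε : 0 < ε) :
    ∃ R : E →L[ℂ] E, (P + (ε : ℂ) • 1) * R = 1 := by
  have hP' : (0 : E →L[ℂ] E) ≤ P := (nonneg_iff_isPositive P).2 hP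
  have hone : IsStrictlyPositive ((ε : ℂ) • (1 : E →L[ℂ] E)) := isStrictlyPositive_one.smul hε
  exact (CStarAlgebra.isUnit_of_le _ (le_add_of_nonneg_left hP') hone).exists_right_inv

/-- `W = T (|T| + ε)⁻¹` is a regularized partial isometry of the polar decomposition of `T`. -/
theorem exists_contraction_re_inner_abs_le (T : E →L[ℂ] E) {ε : ℝ} (hε : 0 < ε) :
    ∃ W : E →L[ℂ] E, ‖W‖ ≤ 1 ∧
      ∀ x, (⟪x, CFC.abs T x⟫_ℂ).re ≤ (⟪W x, T x⟫_ℂ).re + ε * ‖x‖ ^ 2 := by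
  set P := CFC.abs T
  have hP : P.IsPositive := (nonneg_iff_isPositive P).1 (CFC.abs_nonneg T)
  have hPsymm : ∀ x y, ⟪P x, y⟫_ℂ = ⟪x, P y⟫_ℂ := hP.inner_left_eq_inner_right
  obtain ⟨R, hR⟩ := exists_add_smul_mul_eq_one hP hε
  have hRx : ∀ x, P (R x) + (ε : ℂ) • R x = x := fun x => by
    simpa using congrArg (fun X : E →L[ℂ] E => X x) hR
  have hPR : ∀ x, ‖P (R x)‖ ≤ ‖x‖ := fun x => by
    simpa only [hRx] using norm_apply_le_norm_apply_add_smul hP hε.le (R x)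
  refine ⟨T * R, opNorm_le_bound _ zero_le_one fun x => ?_, fun x => ?_⟩
  · rw [mul_apply_eq_comp, ← norm_abs_apply, one_mul]
    exact hPR x
  have hWT : ⟪(T * R) x, T x⟫_ℂ = ⟪P (R x), P x⟫_ℂ := by
    rw [mul_apply_eq_comp, ← adjoint_inner_right, hPsymm]
    change ⟪R x, (star T * T) x⟫_ℂ = ⟪R x, (P * P) x⟫_ℂ
    rw [CFC.abs_mul_abs]
  have hsplit : ⟪x, P x⟫_ℂ = ⟪P (R x), P x⟫_ℂ + ε * ⟪P (R x), x⟫_ℂ := by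
    conv_lhs => rw [← hRx x]
    rw [inner_add_left, inner_smul_left, hRx, ← hPsymm (R x), Complex.conj_ofReal]
  have hrest : (⟪P (R x), x⟫_ℂ).re ≤ ‖x‖ ^ 2 := by
    rw [sq]
    exact (Complex.re_le_norm _).trans ((norm_inner_le_norm _ _).trans
      (mul_le_mul_of_nonneg_right (hPR x) (norm_nonneg x)))
  rw [hWT, hsplit, Complex.add_re, Complex.re_ofReal_mul]
  gcongr

theorem traceNorm_le_ofReal {T : E →L[ℂ] E} {c : ℝ}
    (h : ∀ W : E →L[ℂ] E, ‖W‖ ≤ 1 → ∀ s : Finset (basisIndex E),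
      ∑ i ∈ s, (⟪W (onb E i), T (onb E i)⟫_ℂ).re ≤ c) :
    traceNorm T ≤ ENNReal.ofReal c := by
  have hP : (CFC.abs T).IsPositive := (nonneg_iff_isPositive _).1 (CFC.abs_nonneg T)
  unfold traceNorm
  rw [ENNReal.tsum_eq_iSup_sum]
  refine iSup_le fun s => ?_
  rw [← ENNReal.ofReal_sum_of_nonneg fun i _ => by exact hP.re_inner_nonneg_right (onb E i)]
  refine ENNReal.ofReal_le_ofReal (le_of_forall_pos_le_add fun ε hε => ?_)
  obtain ⟨W, hW, hle⟩ :=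
    exists_contraction_re_inner_abs_le T (show 0 < ε / (s.card + 1) by positivity)
  calc ∑ i ∈ s, (⟪onb E i, CFC.abs T (onb E i)⟫_ℂ).re
      ≤ ∑ i ∈ s, ((⟪W (onb E i), T (onb E i)⟫_ℂ).re + ε / (s.card + 1)) := by
        refine Finset.sum_le_sum fun i _ => ?_
        simpa [(onb E).orthonormal.1 i] using hle (onb E i)
    _ = ∑ i ∈ s, (⟪W (onb E i), T (onb E i)⟫_ℂ).re + s.card / (s.card + 1) * ε := by
        rw [Finset.sum_add_distrib, Finset.sum_const, nsmul_eq_mul]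
        ring
    _ ≤ c + ε := by
        refine add_le_add (h W hW s) (mul_le_of_le_one_left hε.le ?_)
        exact (div_le_one (by positivity)).2 (by linarith)

theorem traceNorm_comp_adjoint_add_le (b : HilbertBasis ι ℂ E) {A B C D : E →L[ℂ] F}
    {α β γ δ : ℝ} (hα : 0 ≤ α) (hβ : 0 ≤ β) (hγ : 0 ≤ γ) (hδ : 0 ≤ δ)
    (hA : hsSq b A ≤ ENNReal.ofReal (α ^ 2)) (hB : hsSq b B ≤ ENNReal.ofReal (β ^ 2))
    (hC : hsSq b C ≤ ENNReal.ofReal (γ ^ 2)) (hD : hsSq b D ≤ ENNReal.ofReal (δ ^ 2)) :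
    traceNorm (A ∘L adjoint B + C ∘L adjoint D) ≤ ENNReal.ofReal (α * β + γ * δ) := by
  refine traceNorm_le_ofReal fun W hW s => ?_
  simp only [add_apply, inner_add_right, Complex.add_re, Finset.sum_add_distrib]
  exact add_le_add (sum_re_inner_comp_adjoint_le b _ hα hβ hA hB hW s)
    (sum_re_inner_comp_adjoint_le b _ hγ hδ hC hD hW s)

end HilbertSchmidt

/-! ### Operators acting on square-summable families of vectors -/

section Amplification

variable {ι E F G : Type*} [NormedAddCommGroup F]

theorem memℓp_two_iff {f : ι → F} : Memℓp f 2 ↔ Summable fun i => ‖f i‖ ^ 2 := by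
  rw [memℓp_gen_iff (by norm_num)]
  norm_num

theorem lp_two_norm_sq_eq_tsum (f : lp (fun _ : ι => F) 2) : ‖f‖ ^ 2 = ∑' i, ‖f i‖ ^ 2 := by
  have hrpow := lp.norm_rpow_eq_tsum (p := 2) (by norm_num) f
  norm_num at hrpow
  exact hrpow

variable [NormedAddCommGroup E] [InnerProductSpace ℂ E] [InnerProductSpace ℂ F]
  [NormedAddCommGroup G] [InnerProductSpace ℂ G]

/-- The family `(X wᵢ)ᵢ`, as a linear function of the operator `X`. Reading `w` as a vector of
`E ⊗ ℓ²(ι)`, this is `(X ⊗ 1) w`, so that `w` plays the role of a pure state. -/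
def amp (w : lp (fun _ : ι => E) 2) : (E →L[ℂ] F) →ₗ[ℂ] lp (fun _ : ι => F) 2 where
  toFun X := ⟨fun i => X (w i), by
    refine memℓp_two_iff.2 (Summable.of_nonneg_of_le (fun _ => sq_nonneg _) (fun i => ?_)
      ((memℓp_two_iff.1 w.2).mul_left (‖X‖ ^ 2)))
    rw [← mul_pow]
    gcongr
    exact X.le_opNorm _⟩
  map_add' _ _ := rfl
  map_smul' _ _ := rfl

variable (w : lp (fun _ : ι => E) 2)

theorem amp_apply (X : E →L[ℂ] F) (i : ι) : amp w X i = X (w i) := rfl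

theorem amp_one : amp w (1 : E →L[ℂ] E) = w := rfl

theorem norm_amp_mono {X : E →L[ℂ] F} {Y : E →L[ℂ] G} (h : ∀ x, ‖X x‖ ≤ ‖Y x‖) :
    ‖amp w X‖ ≤ ‖amp w Y‖ := by
  refine le_of_sq_le_sq ?_ (norm_nonneg _)
  rw [lp_two_norm_sq_eq_tsum, lp_two_norm_sq_eq_tsum]
  refine Summable.tsum_le_tsum (fun i => ?_) (memℓp_two_iff.1 (amp w X).2)
    (memℓp_two_iff.1 (amp w Y).2)
  rw [amp_apply, amp_apply]
  gcongr
  exact h _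

theorem norm_amp_of_norm_map {X : E →L[ℂ] F} (h : ∀ x, ‖X x‖ = ‖x‖) : ‖amp w X‖ = ‖w‖ := by
  conv_rhs => rw [← amp_one w]
  exact le_antisymm (norm_amp_mono w fun x => (h x).le) (norm_amp_mono w fun x => (h x).ge)

theorem norm_amp_comp_le (Y : F →L[ℂ] G) (X : E →L[ℂ] F) :
    ‖amp w (Y ∘L X)‖ ≤ ‖Y‖ * ‖amp w X‖ := by
  have hle : ‖amp w (Y ∘L X)‖ ≤ ‖amp w ((‖Y‖ : ℂ) • X)‖ :=
    norm_amp_mono w fun x => by simpa [norm_smul] using Y.le_opNorm (X x)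
  simpa [norm_smul] using hle

theorem norm_amp_le (X : E →L[ℂ] F) : ‖amp w X‖ ≤ ‖X‖ * ‖w‖ :=
  norm_amp_comp_le w X 1

theorem dist_amp (X Y : E →L[ℂ] F) : dist (amp w X) (amp w Y) = ‖amp w (X - Y)‖ := by
  rw [dist_eq_norm, map_sub]

theorem dist_amp_comp_le (Z : F →L[ℂ] G) (X Y : E →L[ℂ] F) :
    dist (amp w (Z ∘L X)) (amp w (Z ∘L Y)) ≤ ‖Z‖ * dist (amp w X) (amp w Y) := by
  rw [dist_amp, dist_amp, ← comp_sub]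
  exact norm_amp_comp_le w Z _

theorem inner_amp (X Y : E →L[ℂ] F) : ⟪amp w X, amp w Y⟫_ℂ = ∑' i, ⟪X (w i), Y (w i)⟫_ℂ :=
  lp.inner_eq_tsum _ _

theorem inner_amp_eq_inner_amp_adjoint_comp [CompleteSpace E] [CompleteSpace F]
    (X Y : E →L[ℂ] F) : ⟪amp w X, amp w Y⟫_ℂ = ⟪w, amp w (adjoint X ∘L Y)⟫_ℂ := by
  refine (inner_amp w X Y).trans ((tsum_congr fun i => ?_).trans (lp.inner_eq_tsum _ _).symm)
  exact (adjoint_inner_right X (w i) (Y (w i))).symm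

theorem norm_amp_sq_le_re_inner_amp {X : E →L[ℂ] F} {Y : E →L[ℂ] E}
    (h : ∀ x, ‖X x‖ ^ 2 ≤ (⟪x, Y x⟫_ℂ).re) : ‖amp w X‖ ^ 2 ≤ (⟪w, amp w Y⟫_ℂ).re := by
  have hsum : Summable fun i => ⟪w i, amp w Y i⟫_ℂ := lp.summable_inner w (amp w Y)
  rw [lp_two_norm_sq_eq_tsum, lp.inner_eq_tsum, Complex.re_tsum hsum]
  exact (memℓp_two_iff.1 (amp w X).2).tsum_le_tsum (fun i => h (w i))
    (Complex.hasSum_re hsum.hasSum).summable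

end Amplification

/-! ### Purification of a state -/

section Purification

variable {E F : Type*} [NormedAddCommGroup E] [InnerProductSpace ℂ E] [CompleteSpace E]
  [NormedAddCommGroup F] [InnerProductSpace ℂ F] {ρ : E →L[ℂ] E}

theorem adjoint_sqrt (ρ : E →L[ℂ] E) : adjoint (CFC.sqrt ρ) = CFC.sqrt ρ :=
  (CFC.sqrt_nonneg ρ).isSelfAdjoint

theorem inner_apply_eq_norm_sqrt_apply_sq (hρ : ρ.IsPositive) (x : E) :
    ⟪x, ρ x⟫_ℂ = ((‖CFC.sqrt ρ x‖ ^ 2 : ℝ) : ℂ) := by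
  have hmul : CFC.sqrt ρ * CFC.sqrt ρ = ρ :=
    CFC.sqrt_mul_sqrt_self ρ ((nonneg_iff_isPositive ρ).2 hρ)
  conv_lhs => rw [← hmul]
  rw [mul_apply_eq_comp, ← adjoint_inner_left, adjoint_sqrt, inner_self_eq_norm_sq_to_K]
  norm_cast

namespace IsDensityOperator

theorem tsum_norm_sqrt_apply_sq (h : IsDensityOperator ρ) :
    ∑' i, ‖CFC.sqrt ρ (onb E i)‖ ^ 2 = 1 := by
  have htr := h.2
  simp only [trace, inner_apply_eq_norm_sqrt_apply_sq h.1] at htr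
  rw [← Complex.ofReal_tsum] at htr
  exact_mod_cast htr

theorem summable_norm_sqrt_apply_sq (h : IsDensityOperator ρ) :
    Summable fun i => ‖CFC.sqrt ρ (onb E i)‖ ^ 2 := by
  by_contra hns
  exact zero_ne_one ((tsum_eq_zero_of_not_summable hns).symm.trans h.tsum_norm_sqrt_apply_sq)

/-- The purification `(√ρ eᵢ)ᵢ` of the state `ρ`. -/
def purification (h : IsDensityOperator ρ) : lp (fun _ : basisIndex E => E) 2 :=
  ⟨fun i => CFC.sqrt ρ (onb E i), memℓp_two_iff.2 h.summable_norm_sqrt_apply_sq⟩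

theorem norm_purification (h : IsDensityOperator ρ) : ‖h.purification‖ = 1 := by
  have hsq := (lp_two_norm_sq_eq_tsum h.purification).trans h.tsum_norm_sqrt_apply_sq
  exact (pow_eq_one_iff_of_nonneg (norm_nonneg _) two_ne_zero).1 hsq

theorem norm_amp_purification_le (h : IsDensityOperator ρ) (X : E →L[ℂ] F) :
    ‖amp h.purification X‖ ≤ ‖X‖ := by
  simpa [h.norm_purification] using norm_amp_le h.purification X

theorem hsSq_comp_sqrt (h : IsDensityOperator ρ) (X : E →L[ℂ] F) :
    hsSq (onb E) (X ∘L CFC.sqrt ρ) = ENNReal.ofReal (‖amp h.purification X‖ ^ 2) := by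
  rw [lp_two_norm_sq_eq_tsum, ENNReal.ofReal_tsum_of_nonneg (fun _ => sq_nonneg _)
    (memℓp_two_iff.1 (amp h.purification X).2)]
  rfl

variable [CompleteSpace F]

theorem comp_comp_adjoint_eq (h : IsDensityOperator ρ) (X Y : E →L[ℂ] F) :
    X ∘L ρ ∘L adjoint Y = (X ∘L CFC.sqrt ρ) ∘L adjoint (Y ∘L CFC.sqrt ρ) := by
  have hmul : CFC.sqrt ρ * CFC.sqrt ρ = ρ :=
    CFC.sqrt_mul_sqrt_self ρ ((nonneg_iff_isPositive ρ).2 h.1)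
  conv_lhs => rw [← hmul]
  rw [adjoint_comp, adjoint_sqrt]
  rfl

theorem trace_comp_comp_adjoint (h : IsDensityOperator ρ) (X Y : E →L[ℂ] F) :
    trace (X ∘L ρ ∘L adjoint Y) = ⟪amp h.purification Y, amp h.purification X⟫_ℂ := by
  rw [h.comp_comp_adjoint_eq, inner_amp, trace_comp_adjoint (onb E)
    (by rw [h.hsSq_comp_sqrt]; exact ENNReal.ofReal_ne_top)
    (by rw [h.hsSq_comp_sqrt]; exact ENNReal.ofReal_ne_top)]
  rfl

theorem conjIsometry (h : IsDensityOperator ρ) (V : E →ₗᵢ[ℂ] F) :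
    IsDensityOperator (SelfTest.conjIsometry V ρ) := by
  refine ⟨h.1.conj_adjoint V.toContinuousLinearMap, ?_⟩
  rw [SelfTest.conjIsometry, h.trace_comp_comp_adjoint, inner_self_eq_norm_sq_to_K,
    norm_amp_of_norm_map _ V.norm_map, h.norm_purification]
  simp

theorem traceNorm_comp_comp_adjoint_sub_le (h : IsDensityOperator ρ) {X X' Y Y' : E →L[ℂ] F}
    {α β : ℝ} (hXY : dist (amp h.purification X) (amp h.purification Y) ≤ α)
    (hXY' : dist (amp h.purification X') (amp h.purification Y') ≤ β) :
    traceNorm (X ∘L ρ ∘L adjoint X' - Y ∘L ρ ∘L adjoint Y') ≤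
      ENNReal.ofReal (α * ‖X'‖ + ‖Y‖ * β) := by
  have hsplit : X ∘L ρ ∘L adjoint X' - Y ∘L ρ ∘L adjoint Y' =
      (X - Y) ∘L ρ ∘L adjoint X' + Y ∘L ρ ∘L adjoint (X' - Y') := by
    simp only [sub_comp, comp_sub, map_sub]
    abel
  have hhs : ∀ {Z : E →L[ℂ] F} {r : ℝ}, ‖amp h.purification Z‖ ≤ r →
      hsSq (onb E) (Z ∘L CFC.sqrt ρ) ≤ ENNReal.ofReal (r ^ 2) := fun hr => by
    rw [h.hsSq_comp_sqrt]
    gcongr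
  rw [dist_amp] at hXY hXY'
  rw [hsplit, h.comp_comp_adjoint_eq, h.comp_comp_adjoint_eq]
  exact traceNorm_comp_adjoint_add_le (onb E) ((norm_nonneg _).trans hXY) (norm_nonneg _)
    (norm_nonneg _) ((norm_nonneg _).trans hXY') (hhs hXY) (hhs (h.norm_amp_purification_le X'))
    (hhs (h.norm_amp_purification_le Y)) (hhs hXY')

end IsDensityOperator

end Purification

/-! ### Functions of a normal operator -/

section FunctionalCalculus

variable {E : Type*} [NormedAddCommGroup E] [InnerProductSpace ℂ E] [CompleteSpace E]
  {T : E →L[ℂ] E}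

open scoped ComplexOrder in
theorem norm_cfc_apply_sq_le_re_inner {f g : ℂ → ℂ} (hf : ContinuousOn f (spectrum ℂ T))
    (hg : ContinuousOn g (spectrum ℂ T)) (hfg : ∀ z ∈ spectrum ℂ T, ‖f z‖ ^ 2 ≤ (g z).re)
    (x : E) : ‖cfc f T x‖ ^ 2 ≤ (⟪x, cfc g T x⟫_ℂ).re := by
  have hpos : 0 ≤ cfc (fun z => g z + star (g z) - 2 * (star (f z) * f z)) T := by
    refine cfc_nonneg fun z hz => ?_
    have hreal : g z + star (g z) - 2 * (star (f z) * f z) =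
        ((2 * ((g z).re - ‖f z‖ ^ 2) : ℝ) : ℂ) := by
      rw [Complex.star_def, Complex.add_conj, Complex.conj_mul']
      push_cast
      ring
    rw [hreal]
    exact_mod_cast mul_nonneg zero_le_two (sub_nonneg.2 (hfg z hz))
  rw [cfc_sub _ _ T, cfc_add T _ _, cfc_const_mul (2 : ℂ) _ T, cfc_mul _ _ T, cfc_star, cfc_star,
    nonneg_iff_isPositive] at hpos
  have hre := hpos.re_inner_nonneg_right x
  rw [sub_apply, add_apply, smul_apply, inner_sub_right, inner_add_right, inner_smul_right,
    mul_apply_eq_comp, star_eq_adjoint, star_eq_adjoint, adjoint_inner_right, adjoint_inner_right,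
    inner_self_eq_norm_sq_to_K, ← inner_conj_symm (cfc g T x) x] at hre
  have hval : RCLike.re (⟪x, cfc g T x⟫_ℂ + (starRingEnd ℂ) ⟪x, cfc g T x⟫_ℂ
      - 2 * (‖cfc f T x‖ : ℂ) ^ 2) = 2 * (⟪x, cfc g T x⟫_ℂ).re - 2 * ‖cfc f T x‖ ^ 2 := by
    rw [Complex.add_conj, ← Complex.ofReal_pow]
    norm_cast
  linarith [hre.trans_eq hval]

theorem norm_cfc_apply_le_norm_cfc_apply {f g : ℂ → ℂ} (hf : ContinuousOn f (spectrum ℂ T))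
    (hg : ContinuousOn g (spectrum ℂ T)) (hfg : ∀ z ∈ spectrum ℂ T, ‖f z‖ ≤ ‖g z‖) (x : E) :
    ‖cfc f T x‖ ≤ ‖cfc g T x‖ := by
  refine le_of_sq_le_sq ?_ (norm_nonneg _)
  have hinner : (⟪x, cfc (fun z => star (g z) * g z) T x⟫_ℂ).re = ‖cfc g T x‖ ^ 2 := by
    rw [cfc_mul _ _ T, cfc_star, star_eq_adjoint, mul_apply_eq_comp, adjoint_inner_right]
    exact inner_self_eq_norm_sq (𝕜 := ℂ) _
  rw [← hinner]
  refine norm_cfc_apply_sq_le_re_inner hf (hg.star.mul hg) (fun z hz => ?_) x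
  have hre : (star (g z) * g z).re = ‖g z‖ ^ 2 := by
    rw [Complex.star_def, Complex.conj_mul']
    norm_cast
  refine le_of_le_of_eq ?_ hre.symm
  gcongr
  exact hfg z hz

end FunctionalCalculus

/-! ### Trigonometric estimates -/

section Trigonometry

open Real (sin cos pi_pos)
open scoped Real

/-- The sine-weighted cosine polynomial `∑_{k<n} 2 sin(kb) cos(kx)`. For `b = π/n` it is nonpositive
on `[b, 2π - b]`; averaged against a spectral measure it turns bounds on the first `n` moments into
a bound on the `n`-th power. -/
def sineKernel (n : ℕ) (b x : ℝ) : ℝ :=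
  ∑ k ∈ Finset.range n, 2 * sin (k * b) * cos (k * x)

theorem cos_sub_cos_mul_sineKernel (n : ℕ) (b x : ℝ) :
    (cos x - cos b) * sineKernel n b x =
      sin ((n - 1) * b) * cos (n * x) - sin (n * b) * cos ((n - 1) * x) + sin b := by
  unfold sineKernel
  induction n with
  | zero => simp
  | succ n ih =>
    rw [Finset.sum_range_succ, mul_add, ih]
    push_cast
    simp only [add_sub_cancel_right, add_mul, sub_mul, one_mul, Real.sin_add, Real.sin_sub,
      Real.cos_add, Real.cos_sub]
    ring

theorem sin_pi_div_pos {N : ℕ} (hN : 2 ≤ N) : 0 < sin (π / N) := by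
  have hN' : (1 : ℝ) < N := by exact_mod_cast hN
  exact Real.sin_pos_of_pos_of_lt_pi (by positivity) (div_lt_self pi_pos hN')

theorem cos_lt_cos_of_mem_Ioo {b x : ℝ} (hb : 0 ≤ b) (hx : x ∈ Set.Ioo b (2 * π - b)) :
    cos x < cos b := by
  rcases le_total x π with h | h
  · exact Real.cos_lt_cos_of_nonneg_of_le_pi hb h hx.1
  · rw [← Real.cos_two_pi_sub x]
    exact Real.cos_lt_cos_of_nonneg_of_le_pi hb (by linarith) (by linarith [hx.2])

theorem sin_mul_one_add_cos_le_neg_sineKernel {N : ℕ} (hN : 2 ≤ N) {x : ℝ}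
    (hx : x ∈ Set.Icc (π / N) (2 * π - π / N)) :
    sin (π / N) * (1 + cos (N * x)) ≤ 2 * -sineKernel N (π / N) x := by
  set b := π / N with hb
  have hN' : (2 : ℝ) ≤ N := by exact_mod_cast hN
  have hNb : N * b = π := by rw [hb]; field_simp
  have hb0 : 0 < b := by positivity
  have hne : b ≠ 2 * π - b := by nlinarith [pi_pos]
  rw [← closure_Ioo hne] at hx
  refine le_on_closure (f := fun y => sin b * (1 + cos (N * y)))
    (g := fun y => 2 * -sineKernel N b y) (fun y hy => ?_) (by fun_prop)
    (by unfold sineKernel; fun_prop) hx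
  have hidentity := cos_sub_cos_mul_sineKernel N b y
  rw [sub_mul (N : ℝ), hNb, one_mul, Real.sin_pi_sub, Real.sin_pi] at hidentity
  have hnonneg : 0 ≤ sin b * (1 + cos (N * y)) :=
    mul_nonneg (sin_pi_div_pos hN).le (by linarith [Real.neg_one_le_cos (N * y)])
  have hlt := cos_lt_cos_of_mem_Ioo hb0.le hy
  have hkernel : 0 ≤ -sineKernel N b y := by
    by_contra! hneg
    nlinarith
  nlinarith [hkernel, Real.cos_le_one b, Real.neg_one_le_cos y]

theorem sin_mul_le_pi_mul_sin {b y : ℝ} (hb : 0 ≤ b) (hb' : b ≤ π / 2) (hy : 0 ≤ y)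
    (hyb : y ≤ π - b) : sin b * y ≤ π * sin y := by
  rcases le_total y (π / 2) with h | h
  · have hjordan : 2 * y ≤ π * sin y := by
      have := Real.mul_le_sin hy h
      rwa [div_mul_eq_mul_div, div_le_iff₀' pi_pos] at this
    nlinarith [Real.sin_le_one b]
  · have hsin : sin b ≤ sin y := by
      rw [← Real.sin_pi_sub y]
      exact Real.sin_le_sin_of_le_of_le_pi_div_two (by linarith) (by linarith) (by linarith)
    nlinarith [Real.sin_nonneg_of_nonneg_of_le_pi hb (by linarith)]

theorem sin_mul_abs_le_pi_mul_abs_sin {b y : ℝ} (hb : 0 ≤ b) (hb' : b ≤ π / 2)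
    (hy : |y| ≤ π - b) : sin b * |y| ≤ π * |sin y| := by
  have habs : |sin y| = sin |y| := by
    rw [Real.abs_sin_eq_sin_abs_of_abs_le_pi (by linarith)]
  rw [habs]
  exact sin_mul_le_pi_mul_sin hb hb' (abs_nonneg y) hy

theorem norm_exp_sub_exp (x y : ℝ) :
    ‖Complex.exp (-(Complex.I * x)) - Complex.exp (-(Complex.I * y))‖ =
      2 * |sin ((x - y) / 2)| := by
  have hfactor : Complex.exp (-(Complex.I * x)) - Complex.exp (-(Complex.I * y)) =
      Complex.exp (((-y : ℝ) : ℂ) * Complex.I) *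
        (Complex.exp (Complex.I * ((y - x : ℝ) : ℂ)) - 1) := by
    rw [mul_sub, ← Complex.exp_add, mul_one]
    congr 2 <;> push_cast <;> ring
  rw [hfactor, norm_mul, Complex.norm_exp_ofReal_mul_I, one_mul,
    Complex.norm_exp_I_mul_ofReal_sub_one, Real.norm_eq_abs, abs_mul, abs_two, ← neg_sub x y,
    neg_div, Real.sin_neg, abs_neg]

theorem norm_exp_sub_exp_le (x y : ℝ) :
    ‖Complex.exp (-(Complex.I * x)) - Complex.exp (-(Complex.I * y))‖ ≤ |x - y| := by
  have hsin := Real.abs_sin_le_abs (x := (x - y) / 2)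
  rw [abs_div, abs_two] at hsin
  rw [norm_exp_sub_exp]
  linarith

theorem sin_mul_abs_sub_le_norm_exp_sub_exp {b x y : ℝ} (hb : 0 ≤ b) (hb' : b ≤ π / 2)
    (hxy : |x - y| ≤ 2 * π - 2 * b) :
    sin b * |x - y| ≤
      π * ‖Complex.exp (-(Complex.I * x)) - Complex.exp (-(Complex.I * y))‖ := by
  have habs : |(x - y) / 2| = |x - y| / 2 := by rw [abs_div, abs_two]
  have hsin := sin_mul_abs_le_pi_mul_abs_sin hb hb' (y := (x - y) / 2) (by linarith)
  rw [habs] at hsin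
  rw [norm_exp_sub_exp]
  linarith

theorem norm_exp_sub_one_sq (x : ℝ) :
    ‖Complex.exp (-(Complex.I * x)) - 1‖ ^ 2 = 2 * (1 - cos x) := by
  have h := norm_exp_sub_exp x 0
  simp only [Complex.ofReal_zero, mul_zero, neg_zero, Complex.exp_zero, sub_zero] at h
  rw [h, mul_pow, sq_abs, Real.sin_sq_eq_half_sub, mul_div_cancel₀ x two_ne_zero]
  ring

/-- The coefficients of the trigonometric polynomial that dominates `|e^{-iNx} - 1|²` on
`[0, 2π - 2π/N]`; it is `-4 / sin(π/N)` times the kernel `sineKernel N (π/N)` shifted by `π/N`. -/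
def sineWeight (N k : ℕ) : ℂ :=
  ((-(8 / sin (π / N) * sin (k * (π / N))) : ℝ) : ℂ) *
    Complex.exp (-(Complex.I * ((k * (π / N) : ℝ) : ℂ)))

theorem sineWeight_zero (N : ℕ) : sineWeight N 0 = 0 := by
  simp [sineWeight]

theorem norm_exp_neg_I_mul (x : ℝ) : ‖Complex.exp (-(Complex.I * x))‖ = 1 := by
  rw [Complex.norm_exp]
  simp

theorem norm_sineWeight_le {N : ℕ} (hN : 2 ≤ N) (k : ℕ) :
    ‖sineWeight N k‖ ≤ 8 / sin (π / N) := by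
  have hsin := sin_pi_div_pos hN
  rw [sineWeight, norm_mul, norm_exp_neg_I_mul, mul_one, Complex.norm_real, norm_neg, norm_mul,
    Real.norm_of_nonneg (by positivity)]
  exact mul_le_of_le_one_right (by positivity) (Real.abs_sin_le_one _)

theorem re_sineWeight_mul_exp (N k : ℕ) (x : ℝ) :
    (sineWeight N k * Complex.exp (-(Complex.I * ((k * x : ℝ) : ℂ)))).re =
      -(4 / sin (π / N)) * (2 * sin (k * (π / N)) * cos (k * (x + π / N))) := by
  have hexp : Complex.exp (-(Complex.I * ((k * (π / N) : ℝ) : ℂ))) *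
      Complex.exp (-(Complex.I * ((k * x : ℝ) : ℂ))) =
        Complex.exp (((-(k * (x + π / N)) : ℝ) : ℂ) * Complex.I) := by
    rw [← Complex.exp_add]
    congr 1
    push_cast
    ring
  rw [sineWeight, mul_assoc, hexp, Complex.re_ofReal_mul, Complex.exp_ofReal_mul_I_re,
    Real.cos_neg]
  ring

theorem norm_exp_sub_one_sq_le_re_sum {N : ℕ} (hN : 2 ≤ N) {x : ℝ} (hx : 0 ≤ x)
    (hx' : x ≤ 2 * π - 2 * (π / N)) :
    ‖Complex.exp (-(Complex.I * ((N * x : ℝ) : ℂ))) - 1‖ ^ 2 ≤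
      (∑ k ∈ Finset.range N,
        sineWeight N k * Complex.exp (-(Complex.I * ((k * x : ℝ) : ℂ)))).re := by
  have hsin := sin_pi_div_pos hN
  have hkernel := sin_mul_one_add_cos_le_neg_sineKernel hN (x := x + π / N)
    ⟨by linarith, by linarith⟩
  have hcos : cos (N * (x + π / N)) = -cos (N * x) := by
    rw [mul_add, mul_div_cancel₀ π (by positivity), Real.cos_add_pi]
  have hsum : (∑ k ∈ Finset.range N,
      sineWeight N k * Complex.exp (-(Complex.I * ((k * x : ℝ) : ℂ)))).re =
        2 * (2 * -sineKernel N (π / N) (x + π / N)) / sin (π / N) := by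
    rw [Complex.re_sum, sineKernel]
    simp only [re_sineWeight_mul_exp]
    rw [← Finset.mul_sum]
    ring
  rw [norm_exp_sub_one_sq, hsum, le_div_iff₀ hsin]
  rw [hcos] at hkernel
  linarith

end Trigonometry

/-! ### Propagators -/

section Propagator

variable {ι E : Type*} [NormedAddCommGroup E] [InnerProductSpace ℂ E] [CompleteSpace E]
  {H : E →L[ℂ] E}

/-- The propagator `e^{-iHt}`. -/
def propagator (H : E →L[ℂ] E) (t : ℝ) : E →L[ℂ] E :=
  NormedSpace.exp ((-(Complex.I * (t : ℂ))) • H)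

theorem propagator_pow (H : E →L[ℂ] E) (t : ℝ) (j : ℕ) :
    propagator H t ^ j = propagator H (j * t) := by
  let +nondep : NormedAlgebra ℚ (E →L[ℂ] E) := .restrictScalars ℚ ℂ _
  rw [propagator, propagator, ← NormedSpace.exp_nsmul, ← Nat.cast_smul_eq_nsmul ℂ, smul_smul]
  congr 2
  push_cast
  ring

theorem star_propagator (hH : IsSelfAdjoint H) (t : ℝ) :
    star (propagator H t) = NormedSpace.exp ((Complex.I * (t : ℂ)) • H) := by
  rw [propagator, NormedSpace.star_exp, star_smul, hH.star_eq]
  simp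

theorem propagator_mem_unitary (hH : IsSelfAdjoint H) (t : ℝ) :
    propagator H t ∈ unitary (E →L[ℂ] E) := by
  let +nondep : NormedAlgebra ℚ (E →L[ℂ] E) := .restrictScalars ℚ ℂ _
  refine NormedSpace.exp_mem_unitary_of_mem_skewAdjoint ?_
  rw [skewAdjoint.mem_iff, star_smul, hH.star_eq, ← neg_smul]
  simp

theorem norm_propagator_apply (hH : IsSelfAdjoint H) (t : ℝ) (x : E) :
    ‖propagator H t x‖ = ‖x‖ :=
  norm_map_of_mem_unitary (propagator_mem_unitary hH t) x

theorem norm_propagator_le (hH : IsSelfAdjoint H) (t : ℝ) : ‖propagator H t‖ ≤ 1 :=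
  opNorm_le_bound _ zero_le_one fun x => by rw [norm_propagator_apply hH, one_mul]

theorem evolve_eq_comp (hH : IsSelfAdjoint H) (ρ : E →L[ℂ] E) (t : ℝ) :
    evolve H ρ t = propagator H t ∘L ρ ∘L adjoint (propagator H t) := by
  rw [← star_eq_adjoint, star_propagator hH]
  rfl

theorem propagator_eq_cfc (hH : IsSelfAdjoint H) (t : ℝ) :
    propagator H t = cfc (fun z : ℂ => Complex.exp (-(Complex.I * (t : ℂ)) * z)) H := by
  have hnormal : IsStarNormal H := hH.isStarNormal
  have hnormal_smul : IsStarNormal (-(Complex.I * (t : ℂ)) • H) := inferInstance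
  rw [propagator, ← CFC.complex_exp_eq_normedSpace_exp hnormal_smul,
    ← cfc_comp_smul (-(Complex.I * (t : ℂ))) Complex.exp H]
  rfl

theorem propagator_sub_smul_one_eq_cfc (hH : IsSelfAdjoint H) (t : ℝ) (c : ℂ) :
    propagator H t - c • 1 =
      cfc (fun z : ℂ => Complex.exp (-(Complex.I * (t : ℂ)) * z) - c) H := by
  have hnormal : IsStarNormal H := hH.isStarNormal
  rw [propagator_eq_cfc hH, cfc_sub _ _ H, cfc_const c H, Algebra.algebraMap_eq_smul_one]

theorem sum_smul_propagator_eq_cfc (hH : IsSelfAdjoint H) (s : Finset ℕ) (c : ℕ → ℂ)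
    (t : ℕ → ℝ) : ∑ k ∈ s, c k • propagator H (t k) =
      cfc (fun z : ℂ => ∑ k ∈ s, c k * Complex.exp (-(Complex.I * (t k : ℂ)) * z)) H := by
  rw [← Finset.sum_fn, cfc_sum _ H]
  refine Finset.sum_congr rfl fun k _ => ?_
  rw [cfc_const_mul _ _ H, propagator_eq_cfc hH]

theorem exists_mem_Icc_of_mem_spectrum (hH : IsSelfAdjoint H) {Λ : ℝ}
    (hs : spectrum ℝ H ⊆ Set.Icc 0 Λ) {z : ℂ} (hz : z ∈ spectrum ℂ H) :
    ∃ x ∈ Set.Icc 0 Λ, z = (x : ℂ) := by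
  rw [← hH.spectrumRestricts.algebraMap_image] at hz
  obtain ⟨x, hx, rfl⟩ := hz
  exact ⟨x, hs hx, rfl⟩

variable {Λ τ : ℝ}

theorem norm_propagator_sub_apply_le (hH : IsSelfAdjoint H) (hs : spectrum ℝ H ⊆ Set.Icc 0 Λ)
    {b : ℝ} (hb : 0 < b) (hb' : b ≤ Real.pi / 2) (hτ : 0 < τ) (hτΛ : τ * Λ ≤ 2 * Real.pi - 2 * b)
    {x : ℝ} (hx : x ∈ Set.Icc 0 Λ) (t : ℝ) (y : E) :
    ‖(propagator H t - Complex.exp (-(Complex.I * ((t * x : ℝ) : ℂ))) • 1) y‖ ≤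
      |t| * (Real.pi / (τ * Real.sin b)) *
        ‖(propagator H τ - Complex.exp (-(Complex.I * ((τ * x : ℝ) : ℂ))) • 1) y‖ := by
  set κ := Real.pi / (τ * Real.sin b) with hκ
  have hsin : 0 < Real.sin b := Real.sin_pos_of_pos_of_lt_pi hb (by linarith [Real.pi_pos])
  have hscale : ∀ X : E →L[ℂ] E, |t| * κ * ‖X y‖ = ‖(((|t| * κ : ℝ) : ℂ) • X) y‖ := fun X => by
    rw [smul_apply, norm_smul, Complex.norm_real, Real.norm_of_nonneg (by positivity)]
  rw [hscale, propagator_sub_smul_one_eq_cfc hH, propagator_sub_smul_one_eq_cfc hH,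
    ← cfc_const_mul _ _ H]
  refine norm_cfc_apply_le_norm_cfc_apply (by fun_prop) (by fun_prop) (fun z hz => ?_) y
  obtain ⟨x', hx', rfl⟩ := exists_mem_Icc_of_mem_spectrum hH hs hz
  have hcast : ∀ s : ℝ, -(Complex.I * (s : ℂ)) * (x' : ℂ) = -(Complex.I * ((s * x' : ℝ) : ℂ)) :=
    fun s => by push_cast; ring
  have habs : |τ * x' - τ * x| = τ * |x' - x| := by rw [← mul_sub, abs_mul, abs_of_pos hτ]
  have hdist : τ * |x' - x| ≤ 2 * Real.pi - 2 * b :=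
    (mul_le_mul_of_nonneg_left (abs_sub_le_of_nonneg_of_le hx'.1 hx'.2 hx.1 hx.2) hτ.le).trans
      hτΛ
  rw [norm_mul, Complex.norm_real, Real.norm_of_nonneg (by positivity), hcast, hcast]
  calc ‖Complex.exp (-(Complex.I * ((t * x' : ℝ) : ℂ))) -
        Complex.exp (-(Complex.I * ((t * x : ℝ) : ℂ)))‖
      ≤ |t * x' - t * x| := norm_exp_sub_exp_le _ _
    _ = |t| * (1 / (τ * Real.sin b)) * (Real.sin b * |τ * x' - τ * x|) := by
        rw [habs, ← mul_sub, abs_mul]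
        field_simp
    _ ≤ |t| * (1 / (τ * Real.sin b)) *
          (Real.pi * ‖Complex.exp (-(Complex.I * ((τ * x' : ℝ) : ℂ))) -
            Complex.exp (-(Complex.I * ((τ * x : ℝ) : ℂ)))‖) := by
        refine mul_le_mul_of_nonneg_left ?_ (by positivity)
        exact sin_mul_abs_sub_le_norm_exp_sub_exp hb.le hb' (habs.trans_le hdist)
    _ = _ := by rw [hκ]; ring

theorem norm_propagator_pow_sub_one_apply_sq_le {N : ℕ} (hN : 2 ≤ N) (hH : IsSelfAdjoint H)
    (hs : spectrum ℝ H ⊆ Set.Icc 0 Λ) (hτ : 0 ≤ τ)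
    (hτΛ : τ * Λ ≤ 2 * Real.pi - 2 * (Real.pi / N)) (y : E) :
    ‖(propagator H τ ^ N - 1) y‖ ^ 2 ≤
      (⟪y, (∑ k ∈ Finset.range N, sineWeight N k • propagator H τ ^ k) y⟫_ℂ).re := by
  simp only [propagator_pow]
  rw [← one_smul ℂ (1 : E →L[ℂ] E), propagator_sub_smul_one_eq_cfc hH,
    sum_smul_propagator_eq_cfc hH _ (sineWeight N) fun k => k * τ]
  refine norm_cfc_apply_sq_le_re_inner (by fun_prop) (by fun_prop) (fun z hz => ?_) y
  obtain ⟨x, hx, rfl⟩ := exists_mem_Icc_of_mem_spectrum hH hs hz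
  have hcast : ∀ k : ℕ, -(Complex.I * ((k * τ : ℝ) : ℂ)) * (x : ℂ) =
      -(Complex.I * ((k * (τ * x) : ℝ) : ℂ)) := fun k => by push_cast; ring
  simp only [hcast]
  exact norm_exp_sub_one_sq_le_re_sum hN (mul_nonneg hτ hx.1)
    ((mul_le_mul_of_nonneg_left hx.2 hτ).trans hτΛ)

theorem norm_amp_propagator_pow_sub_one_sq_le {N : ℕ} (hN : 2 ≤ N) (hH : IsSelfAdjoint H)
    (hs : spectrum ℝ H ⊆ Set.Icc 0 Λ) (hτ : 0 ≤ τ)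
    (hτΛ : τ * Λ ≤ 2 * Real.pi - 2 * (Real.pi / N)) (w : lp (fun _ : ι => E) 2) {η : ℝ}
    (hη : ∀ j, 0 < j → j < N → ‖⟪w, amp w (propagator H τ ^ j)⟫_ℂ‖ ≤ η) :
    ‖amp w (propagator H τ ^ N - 1)‖ ^ 2 ≤ N * (8 / Real.sin (Real.pi / N) * η) := by
  have hη0 : 0 ≤ η := (norm_nonneg _).trans (hη 1 one_pos hN)
  have hsin := sin_pi_div_pos hN
  refine (norm_amp_sq_le_re_inner_amp w
    (norm_propagator_pow_sub_one_apply_sq_le hN hH hs hτ hτΛ)).trans ?_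
  simp only [map_sum, map_smul, inner_sum, inner_smul_right]
  refine (Complex.re_le_norm _).trans ((norm_sum_le_of_le _ fun k hk => ?_).trans_eq (by
    rw [Finset.sum_const, Finset.card_range, nsmul_eq_mul]))
  rcases Nat.eq_zero_or_pos k with rfl | hk0
  · rw [sineWeight_zero, zero_mul, norm_zero]
    positivity
  · rw [norm_mul]
    exact mul_le_mul (norm_sineWeight_le hN k) (hη k hk0 (Finset.mem_range.1 hk))
      (norm_nonneg _) (by positivity)

end Propagator

/-! ### Approximate spectral projections of a nearly cyclic unitary -/

/-- The primitive root of unity `e^{2πi/N}`. -/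
def unityRoot (N : ℕ) : ℂ := Complex.exp (2 * Real.pi * Complex.I / N)

theorem isPrimitiveRoot_unityRoot {N : ℕ} (hN : N ≠ 0) : IsPrimitiveRoot (unityRoot N) N :=
  Complex.isPrimitiveRoot_exp N hN

theorem norm_unityRoot {N : ℕ} (hN : N ≠ 0) : ‖unityRoot N‖ = 1 :=
  (isPrimitiveRoot_unityRoot hN).norm'_eq_one hN

theorem average_unityRoot_pow {N : ℕ} (l k : Fin N) :
    (N : ℂ)⁻¹ * ∑ j ∈ Finset.range N,
      (unityRoot N ^ (l : ℕ) * (unityRoot N ^ (k : ℕ))⁻¹) ^ j = if l = k then 1 else 0 := by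
  have hN : N ≠ 0 := (l.pos).ne'
  have hroot := isPrimitiveRoot_unityRoot hN
  have hne : unityRoot N ^ (k : ℕ) ≠ 0 := pow_ne_zero _ (hroot.ne_zero hN)
  split_ifs with hlk
  · simp [hlk, mul_inv_cancel₀ hne, hN]
  · have hratio : unityRoot N ^ (l : ℕ) * (unityRoot N ^ (k : ℕ))⁻¹ ≠ 1 := fun h =>
      hlk (Fin.ext (hroot.pow_inj l.2 k.2 ((mul_inv_eq_one₀ hne).1 h)))
    have hpow : (unityRoot N ^ (l : ℕ) * (unityRoot N ^ (k : ℕ))⁻¹) ^ N = 1 := by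
      rw [mul_pow, inv_pow, pow_right_comm, pow_right_comm _ (k : ℕ), hroot.pow_eq_one, one_pow,
        one_pow, inv_one, one_mul]
    rw [geom_sum_eq hratio, hpow, sub_self, zero_div, mul_zero]

theorem star_geom_sum_mul_pow {A : Type*} [Ring A] [StarRing A] (N : ℕ) {v : A}
    (hv : star v * v = 1) :
    star (∑ j ∈ Finset.range N, v ^ j) * v ^ N = ∑ j ∈ Finset.range N, v ^ (j + 1) := by
  have hisometry : ∀ j, star (v ^ j) * v ^ j = 1 := fun j => by
    induction j with
    | zero => simp
    | succ j ih => rw [pow_succ', star_mul, mul_assoc, ← mul_assoc (star v), hv, one_mul, ih]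
  induction N with
  | zero => simp
  | succ N ih =>
    rw [Finset.sum_range_succ, star_add, pow_succ, add_mul, ← mul_assoc, ih, ← mul_assoc,
      hisometry, Finset.sum_range_succ', Finset.sum_mul]
    simp only [← pow_succ, one_mul, zero_add, pow_one]

section PowerAverage

variable {A : Type*} [Ring A] [Algebra ℂ A]

/-- The average of the first `N` powers of `v`; when `v` is unitary and `v ^ N = 1`, this is the
projection onto the vectors fixed by `v`. -/
def powerAverage (N : ℕ) (v : A) : A := (N : ℂ)⁻¹ • ∑ j ∈ Finset.range N, v ^ j

/-- The Fourier component of `u` at the frequency `k`; when `u` is unitary and `u ^ N = 1`, this is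
the spectral projection of `u` for the eigenvalue `e^{-2πik/N}`. -/
def phaseProj (N : ℕ) (u : A) (k : ℕ) : A := powerAverage N (unityRoot N ^ k • u)

theorem sub_one_mul_powerAverage (N : ℕ) (v : A) :
    (v - 1) * powerAverage N v = (N : ℂ)⁻¹ • (v ^ N - 1) := by
  rw [powerAverage, mul_smul_comm, mul_geom_sum]

theorem pow_mul_powerAverage_sub (N : ℕ) (v : A) (j : ℕ) :
    v ^ j * powerAverage N v - powerAverage N v =
      (N : ℂ)⁻¹ • ∑ i ∈ Finset.range j, v ^ i * (v ^ N - 1) := by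
  rw [← Finset.sum_mul, ← mul_smul_comm, ← sub_one_mul_powerAverage, ← mul_assoc, geom_sum_mul,
    sub_mul, one_mul]

theorem unityRoot_pow_smul_pow_self {N : ℕ} (hN : N ≠ 0) (k : ℕ) (u : A) :
    (unityRoot N ^ k • u) ^ N = u ^ N := by
  rw [smul_pow, pow_right_comm, (isPrimitiveRoot_unityRoot hN).pow_eq_one, one_pow, one_smul]

theorem sum_phaseProj {N : ℕ} (hN : N ≠ 0) (u : A) : ∑ k : Fin N, phaseProj N u k = 1 := by
  have hcoeff : ∀ j ∈ Finset.range N,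
      (N : ℂ)⁻¹ * ∑ k : Fin N, (unityRoot N ^ (k : ℕ)) ^ j = if j = 0 then 1 else 0 := by
    intro j hj
    have haverage := average_unityRoot_pow ⟨j, Finset.mem_range.1 hj⟩ ⟨0, Nat.pos_of_ne_zero hN⟩
    simp only [Fin.mk.injEq, pow_zero, inv_one, mul_one] at haverage
    rw [← haverage, Finset.sum_range]
    simp only [pow_right_comm]
  simp only [phaseProj, powerAverage, smul_pow]
  rw [← Finset.smul_sum, Finset.sum_comm, Finset.smul_sum]
  simp only [← Finset.sum_smul, smul_smul]
  rw [Finset.sum_congr rfl fun j hj => by rw [hcoeff j hj]]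
  simp [Nat.pos_of_ne_zero hN]

theorem phaseProj_mul {N : ℕ} (hN : N ≠ 0) (u : A) (l k : ℕ) (X : A) :
    phaseProj N u l * X = (N : ℂ)⁻¹ • ∑ j ∈ Finset.range N,
      (unityRoot N ^ l * (unityRoot N ^ k)⁻¹) ^ j • ((unityRoot N ^ k • u) ^ j * X) := by
  have hne : unityRoot N ^ k ≠ 0 := pow_ne_zero _ ((isPrimitiveRoot_unityRoot hN).ne_zero hN)
  rw [phaseProj, powerAverage, smul_mul_assoc, Finset.sum_mul]
  simp only [← smul_mul_assoc, ← smul_pow, smul_smul, inv_mul_cancel_right₀ hne]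

variable [StarRing A] [StarModule ℂ A]

theorem star_powerAverage_sub (N : ℕ) {v : A} (hv : star v * v = 1) :
    star (powerAverage N v) - powerAverage N v =
      ((N : ℂ)⁻¹ • 1 - star (powerAverage N v)) * (v ^ N - 1) := by
  have hshift : ∑ j ∈ Finset.range N, v ^ (j + 1) = ∑ j ∈ Finset.range N, v ^ j + v ^ N - 1 := by
    rw [← Finset.sum_range_succ, Finset.sum_range_succ', pow_zero, add_sub_cancel_right]
  have hstar : star (powerAverage N v) * v ^ N =
      powerAverage N v + (N : ℂ)⁻¹ • (v ^ N - 1) := by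
    rw [powerAverage, star_smul, smul_mul_assoc, star_geom_sum_mul_pow N hv, hshift, star_inv₀,
      star_natCast, ← smul_add, add_sub_assoc]
  rw [sub_mul, mul_sub (star _), hstar, smul_one_mul, mul_one]
  abel

end PowerAverage

section NearlyCyclic

variable {ι E F : Type*} [NormedAddCommGroup E] [InnerProductSpace ℂ E]
  [NormedAddCommGroup F] [InnerProductSpace ℂ F]

theorem dist_amp_average_le (w : lp (fun _ : ι => E) 2) {N : ℕ} (hN : N ≠ 0) {c : ℕ → ℂ}
    (hc : ∀ j, ‖c j‖ ≤ 1) {X Y : ℕ → E →L[ℂ] F} {ε : ℝ}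
    (h : ∀ j < N, dist (amp w (X j)) (amp w (Y j)) ≤ ε) :
    dist (amp w ((N : ℂ)⁻¹ • ∑ j ∈ Finset.range N, c j • X j))
      (amp w ((N : ℂ)⁻¹ • ∑ j ∈ Finset.range N, c j • Y j)) ≤ ε := by
  simp only [map_smul, map_sum, dist_smul₀, norm_inv, Complex.norm_natCast]
  rw [inv_mul_le_iff₀ (by positivity)]
  refine (dist_sum_sum_le_of_le _ fun j hj => ?_).trans_eq
    (by rw [Finset.sum_const, Finset.card_range, nsmul_eq_mul])
  rw [dist_smul₀]
  exact (mul_le_of_le_one_left dist_nonneg (hc j)).trans (h j (Finset.mem_range.1 hj))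

theorem norm_pow_le_one {U : E →L[ℂ] E} (hU : ‖U‖ ≤ 1) (j : ℕ) : ‖U ^ j‖ ≤ 1 := by
  induction j with
  | zero => exact norm_id_le
  | succ j ih =>
    rw [pow_succ]
    exact (norm_mul_le _ _).trans (mul_le_one₀ ih (norm_nonneg _) hU)

theorem norm_powerAverage_le {N : ℕ} (hN : N ≠ 0) {U : E →L[ℂ] E} (hU : ‖U‖ ≤ 1) :
    ‖powerAverage N U‖ ≤ 1 := by
  rw [powerAverage, norm_smul, norm_inv, Complex.norm_natCast, inv_mul_le_iff₀ (by positivity)]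
  exact (norm_sum_le_of_le _ fun j _ => norm_pow_le_one hU j).trans_eq (by simp)

theorem dist_amp_pow_mul_powerAverage_le (w : lp (fun _ : ι => E) 2) {N j : ℕ} (hN : N ≠ 0)
    (hj : j ≤ N) {U : E →L[ℂ] E} (hU : ‖U‖ ≤ 1) :
    dist (amp w (U ^ j * powerAverage N U)) (amp w (powerAverage N U)) ≤
      ‖amp w (U ^ N - 1)‖ := by
  rw [dist_amp, pow_mul_powerAverage_sub, map_smul, map_sum, norm_smul, norm_inv,
    Complex.norm_natCast, inv_mul_le_iff₀ (by positivity)]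
  have hterm : ∀ i ∈ Finset.range j, ‖amp w (U ^ i * (U ^ N - 1))‖ ≤ ‖amp w (U ^ N - 1)‖ :=
    fun i _ => (norm_amp_comp_le w _ _).trans
      (mul_le_of_le_one_left (norm_nonneg _) (norm_pow_le_one hU i))
  refine (norm_sum_le_of_le _ hterm).trans ?_
  rw [Finset.sum_const, Finset.card_range, nsmul_eq_mul]
  gcongr

variable [CompleteSpace E]

theorem norm_le_one_of_star_mul_self {U : E →L[ℂ] E} (hU : star U * U = 1) : ‖U‖ ≤ 1 := by
  rw [← sq_le_one_iff₀ (norm_nonneg U), sq, ← CStarRing.norm_star_mul_self, hU]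
  exact norm_id_le

/-- On the family `w`, the isometry `U` is approximately a cyclic shift of order `N`: up to `η`, the
vectors of `w` lie in the range of the effect `M₀` and their images under `U, …, U ^ (N - 1)` are
annihilated by it, and `U ^ N` fixes them up to `ζ`. -/
structure NearlyCyclic (N : ℕ) (w : lp (fun _ : ι => E) 2) (U M₀ : E →L[ℂ] E) (η ζ : ℝ) :
    Prop where
  ne_zero : N ≠ 0
  star_mul_self : star U * U = 1
  isSelfAdjoint : IsSelfAdjoint M₀
  norm_le : ‖M₀‖ ≤ 1
  norm_amp_one_sub : ‖amp w (1 - M₀)‖ ≤ η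
  norm_amp_mul_pow : ∀ j, 0 < j → j < N → ‖amp w (M₀ * U ^ j)‖ ≤ η
  norm_amp_pow_sub_one : ‖amp w (U ^ N - 1)‖ ≤ ζ

namespace NearlyCyclic

variable {N : ℕ} {w : lp (fun _ : ι => E) 2} {U M₀ : E →L[ℂ] E} {η ζ : ℝ}

theorem one_le_cast (h : NearlyCyclic N w U M₀ η ζ) : (1 : ℝ) ≤ N :=
  Nat.one_le_cast.2 (Nat.one_le_iff_ne_zero.2 h.ne_zero)

theorem eta_nonneg (h : NearlyCyclic N w U M₀ η ζ) : 0 ≤ η :=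
  (norm_nonneg _).trans h.norm_amp_one_sub

theorem zeta_nonneg (h : NearlyCyclic N w U M₀ η ζ) : 0 ≤ ζ :=
  (norm_nonneg _).trans h.norm_amp_pow_sub_one

theorem star_phase_mul_self (h : NearlyCyclic N w U M₀ η ζ) (k : ℕ) :
    star (unityRoot N ^ k • U) * (unityRoot N ^ k • U) = 1 := by
  rw [star_smul, smul_mul_smul_comm, h.star_mul_self, Complex.star_def, Complex.conj_mul',
    norm_pow, norm_unityRoot h.ne_zero]
  simp

theorem norm_phase_le (h : NearlyCyclic N w U M₀ η ζ) (k : ℕ) : ‖unityRoot N ^ k • U‖ ≤ 1 :=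
  norm_le_one_of_star_mul_self (h.star_phase_mul_self k)

theorem norm_phaseProj_le (h : NearlyCyclic N w U M₀ η ζ) (k : ℕ) : ‖phaseProj N U k‖ ≤ 1 :=
  norm_powerAverage_le h.ne_zero (h.norm_phase_le k)

theorem norm_adjoint_phaseProj_le (h : NearlyCyclic N w U M₀ η ζ) (k : ℕ) :
    ‖adjoint (phaseProj N U k)‖ ≤ 1 := by
  rw [LinearIsometryEquiv.norm_map]
  exact h.norm_phaseProj_le k

theorem dist_amp_adjoint_phaseProj_le (h : NearlyCyclic N w U M₀ η ζ) (k : ℕ) :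
    dist (amp w (adjoint (phaseProj N U k))) (amp w (phaseProj N U k)) ≤ 2 * ζ := by
  have hcoeff : ‖(N : ℂ)⁻¹ • (1 : E →L[ℂ] E) - adjoint (phaseProj N U k)‖ ≤ 2 := by
    refine (norm_sub_le_of_le (r₁ := 1) ?_ (h.norm_adjoint_phaseProj_le k)).trans (by norm_num)
    rw [norm_smul, norm_inv, Complex.norm_natCast]
    exact mul_le_one₀ (inv_le_one_of_one_le₀ h.one_le_cast) (norm_nonneg _) norm_id_le
  have hdefect := star_powerAverage_sub N (h.star_phase_mul_self k)
  rw [unityRoot_pow_smul_pow_self h.ne_zero] at hdefect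
  rw [dist_amp, ← star_eq_adjoint, phaseProj, hdefect]
  exact (norm_amp_comp_le w _ _).trans
    (mul_le_mul hcoeff h.norm_amp_pow_sub_one (norm_nonneg _) zero_le_two)

theorem dist_amp_phaseProj_mul_phaseProj_le (h : NearlyCyclic N w U M₀ η ζ) (l k : Fin N) :
    dist (amp w (phaseProj N U l * phaseProj N U k))
      (amp w ((if l = k then (1 : ℂ) else 0) • phaseProj N U k)) ≤ ζ := by
  rw [phaseProj_mul h.ne_zero U l k, ← average_unityRoot_pow l k, mul_smul, Finset.sum_smul]
  refine dist_amp_average_le w h.ne_zero (fun j => ?_) fun j hj => ?_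
  · simp [norm_unityRoot h.ne_zero]
  · refine (dist_amp_pow_mul_powerAverage_le w h.ne_zero hj.le (h.norm_phase_le k)).trans ?_
    rw [unityRoot_pow_smul_pow_self h.ne_zero]
    exact h.norm_amp_pow_sub_one

theorem dist_amp_mul_phaseProj_le (h : NearlyCyclic N w U M₀ η ζ) (k : ℕ) :
    dist (amp w (M₀ * phaseProj N U k)) (amp w ((N : ℂ)⁻¹ • 1)) ≤ η := by
  have hproj : M₀ * phaseProj N U k =
      (N : ℂ)⁻¹ • ∑ j ∈ Finset.range N, (unityRoot N ^ k) ^ j • (M₀ * U ^ j) := by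
    simp only [phaseProj, powerAverage, smul_pow, mul_smul_comm, Finset.mul_sum]
  have hone : (N : ℂ)⁻¹ • (1 : E →L[ℂ] E) =
      (N : ℂ)⁻¹ • ∑ j ∈ Finset.range N, (unityRoot N ^ k) ^ j • if j = 0 then 1 else 0 := by
    simp [h.ne_zero]
  rw [hproj, hone]
  refine dist_amp_average_le w h.ne_zero (fun j => ?_) fun j hj => ?_
  · simp [norm_unityRoot h.ne_zero]
  rcases Nat.eq_zero_or_pos j with rfl | hj0
  · rw [if_pos rfl, pow_zero, mul_one, dist_comm, dist_amp]
    exact h.norm_amp_one_sub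
  · rw [if_neg hj0.ne', dist_amp, sub_zero]
    exact h.norm_amp_mul_pow j hj0 hj

end NearlyCyclic

end NearlyCyclic

/-! ### The Cayley dilation -/

section CayleyDilation

variable {E F : Type*} [NormedAddCommGroup E] [InnerProductSpace ℂ E] [CompleteSpace E]
  [NormedAddCommGroup F] [InnerProductSpace ℂ F] [CompleteSpace F] (A : E →L[ℂ] F)

/-- The operator `(1 + A† A)⁻¹`. -/
def cayleyResolvent : E →L[ℂ] E := Ring.inverse (1 + adjoint A ∘L A)

/-- The contraction `2 A (1 + A† A)⁻¹`, which agrees with `A` when `A` is isometric. -/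
def cayleyContraction : E →L[ℂ] F := (2 : ℂ) • (A ∘L cayleyResolvent A)

/-- The Cayley transform `(1 - A† A) (1 + A† A)⁻¹ = 2 (1 + A† A)⁻¹ - 1` of `A† A`. By the rational
parametrization of the unit circle it is the defect operator of `cayleyContraction A`. -/
def cayleyDefect : E →L[ℂ] E := (2 : ℂ) • cayleyResolvent A - 1

theorem isUnit_one_add_adjoint_comp_self : IsUnit (1 + adjoint A ∘L A) :=
  CStarAlgebra.isUnit_of_le 1
    (le_add_of_nonneg_right ((nonneg_iff_isPositive _).2 (isPositive_adjoint_comp_self A)))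
    isStrictlyPositive_one

theorem one_add_mul_cayleyResolvent : (1 + adjoint A ∘L A) * cayleyResolvent A = 1 :=
  Ring.mul_inverse_cancel _ (isUnit_one_add_adjoint_comp_self A)

theorem cayleyResolvent_mul_one_add : cayleyResolvent A * (1 + adjoint A ∘L A) = 1 :=
  Ring.inverse_mul_cancel _ (isUnit_one_add_adjoint_comp_self A)

theorem cayleyContraction_eq_comp : cayleyContraction A = A ∘L (1 + cayleyDefect A) := by
  rw [cayleyContraction, cayleyDefect, add_sub_cancel, comp_smul]

theorem cayleyDefect_eq_mul :
    cayleyDefect A = cayleyResolvent A * (1 - adjoint A ∘L A) := by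
  have htwo : (1 - adjoint A ∘L A) = (2 : ℂ) • 1 - (1 + adjoint A ∘L A) := by
    rw [two_smul]
    abel
  rw [htwo, mul_sub, mul_smul_comm, mul_one, cayleyResolvent_mul_one_add, cayleyDefect]

theorem re_inner_adjoint_apply_self (y : E) : (⟪y, adjoint A (A y)⟫_ℂ).re = ‖A y‖ ^ 2 := by
  rw [adjoint_inner_right]
  exact inner_self_eq_norm_sq (𝕜 := ℂ) (A y)

theorem norm_cayleyResolvent_le : ‖cayleyResolvent A‖ ≤ 1 := by
  refine opNorm_le_bound _ zero_le_one fun x => ?_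
  set y := cayleyResolvent A x
  have hx : y + adjoint A (A y) = x := DFunLike.congr_fun (one_add_mul_cayleyResolvent A) x
  have hsq := norm_add_sq (𝕜 := ℂ) y (adjoint A (A y))
  rw [RCLike.re_eq_complex_re, re_inner_adjoint_apply_self, hx] at hsq
  rw [one_mul]
  exact le_of_sq_le_sq (by nlinarith [sq_nonneg ‖A y‖, sq_nonneg ‖adjoint A (A y)‖])
    (norm_nonneg x)

theorem norm_cayleyContraction_sq_add_norm_cayleyDefect_sq (x : E) :
    ‖cayleyContraction A x‖ ^ 2 + ‖cayleyDefect A x‖ ^ 2 = ‖x‖ ^ 2 := by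
  set y := cayleyResolvent A x with hy
  have hx : y + adjoint A (A y) = x := DFunLike.congr_fun (one_add_mul_cayleyResolvent A) x
  have hcontraction : ‖cayleyContraction A x‖ = 2 * ‖A y‖ := by
    rw [cayleyContraction, smul_apply, norm_smul, RCLike.norm_ofNat, comp_apply, hy]
  have hdefect : cayleyDefect A x = y - adjoint A (A y) := by
    rw [cayleyDefect, sub_apply, smul_apply, ← hy, one_apply_eq_self, two_smul]
    rw [← hx]
    abel
  have hadd := norm_add_sq (𝕜 := ℂ) y (adjoint A (A y))
  have hsub := norm_sub_sq (𝕜 := ℂ) y (adjoint A (A y))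
  rw [RCLike.re_eq_complex_re, re_inner_adjoint_apply_self] at hadd hsub
  rw [hcontraction, hdefect, ← hx, hadd, hsub]
  ring

variable {G : Type*} [NormedAddCommGroup G] [InnerProductSpace ℂ G] {J₁ : F →ₗᵢ[ℂ] G}
  {J₂ : E →ₗᵢ[ℂ] G}

/-- The isometric dilation `J₁ T + J₂ D` of `T = cayleyContraction A`, with `D = cayleyDefect A`,
for isometries `J₁` and `J₂` with orthogonal ranges. -/
def cayleyIsometry (hJ : ∀ x y, ⟪J₁ x, J₂ y⟫_ℂ = 0) : E →ₗᵢ[ℂ] G where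
  toLinearMap := (J₁.toContinuousLinearMap ∘L cayleyContraction A +
    J₂.toContinuousLinearMap ∘L cayleyDefect A).toLinearMap
  norm_map' x := by
    refine (sq_eq_sq₀ (norm_nonneg _) (norm_nonneg _)).1 ?_
    have hpythagoras := norm_add_sq_eq_norm_sq_add_norm_sq_of_inner_eq_zero (𝕜 := ℂ)
      (J₁ (cayleyContraction A x)) (J₂ (cayleyDefect A x)) (hJ _ _)
    rw [J₁.norm_map, J₂.norm_map] at hpythagoras
    rw [← norm_cayleyContraction_sq_add_norm_cayleyDefect_sq A x, sq, sq, sq]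
    exact hpythagoras

theorem cayleyIsometry_toContinuousLinearMap (hJ : ∀ x y, ⟪J₁ x, J₂ y⟫_ℂ = 0) :
    (cayleyIsometry A hJ).toContinuousLinearMap =
      J₁.toContinuousLinearMap ∘L cayleyContraction A +
        J₂.toContinuousLinearMap ∘L cayleyDefect A := rfl

variable {ι : Type*} {w : lp (fun _ : ι => E) 2} {X : E →L[ℂ] E} {Y : E →L[ℂ] F} {α β : ℝ}

theorem norm_amp_cayleyDefect_comp_le (hAX : dist (amp w (A ∘L X)) (amp w Y) ≤ α)
    (hAY : dist (amp w (adjoint A ∘L Y)) (amp w X) ≤ β) :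
    ‖amp w (cayleyDefect A ∘L X)‖ ≤ β + ‖A‖ * α := by
  have hadjoint : dist (amp w (adjoint A ∘L Y)) (amp w (adjoint A ∘L A ∘L X)) ≤ ‖A‖ * α := by
    refine (dist_amp_comp_le w _ _ _).trans ?_
    rw [LinearIsometryEquiv.norm_map, dist_comm]
    gcongr
  have hdefect : cayleyDefect A ∘L X = cayleyResolvent A ∘L (X - adjoint A ∘L A ∘L X) := by
    rw [cayleyDefect_eq_mul]
    rfl
  rw [hdefect]
  refine (norm_amp_comp_le w _ _).trans
    ((mul_le_of_le_one_left (norm_nonneg _) (norm_cayleyResolvent_le A)).trans ?_)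
  rw [← dist_amp]
  exact (dist_triangle_left _ _ _).trans (add_le_add hAY hadjoint)

theorem dist_amp_cayleyIsometry_comp_le (hJ : ∀ x y, ⟪J₁ x, J₂ y⟫_ℂ = 0)
    (hAX : dist (amp w (A ∘L X)) (amp w Y) ≤ α)
    (hAY : dist (amp w (adjoint A ∘L Y)) (amp w X) ≤ β) :
    dist (amp w ((cayleyIsometry A hJ).toContinuousLinearMap ∘L X))
      (amp w (J₁.toContinuousLinearMap ∘L Y)) ≤ α + (‖A‖ + 1) * (β + ‖A‖ * α) := by
  have hdefect := norm_amp_cayleyDefect_comp_le A hAX hAY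
  have hsplit : (cayleyIsometry A hJ).toContinuousLinearMap ∘L X -
      J₁.toContinuousLinearMap ∘L Y = J₁.toContinuousLinearMap ∘L (A ∘L X - Y) +
        (J₁.toContinuousLinearMap ∘L A ∘L cayleyDefect A ∘L X +
          J₂.toContinuousLinearMap ∘L cayleyDefect A ∘L X) := by
    rw [cayleyIsometry_toContinuousLinearMap, cayleyContraction_eq_comp]
    ext x
    simp only [add_apply, sub_apply, comp_apply, one_apply_eq_self, map_add, map_sub]
    abel
  have hcontraction : ‖amp w (A ∘L cayleyDefect A ∘L X)‖ ≤ ‖A‖ * (β + ‖A‖ * α) :=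
    (norm_amp_comp_le w _ _).trans (by gcongr)
  have hJ₁ : ∀ Z : E →L[ℂ] F, ‖amp w (J₁.toContinuousLinearMap ∘L Z)‖ ≤ ‖amp w Z‖ := fun Z =>
    norm_amp_mono w fun x => (J₁.norm_map (Z x)).le
  have hJ₂ : ∀ Z : E →L[ℂ] E, ‖amp w (J₂.toContinuousLinearMap ∘L Z)‖ ≤ ‖amp w Z‖ := fun Z =>
    norm_amp_mono w fun x => (J₂.norm_map (Z x)).le
  rw [dist_amp, hsplit, map_add, map_add, add_mul, one_mul]
  refine norm_add_le_of_le ((hJ₁ _).trans ?_)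
    (norm_add_le_of_le ((hJ₁ _).trans hcontraction) ((hJ₂ _).trans hdefect))
  rwa [← dist_amp]

end CayleyDilation

/-! ### The reference vector and measurement -/

section Reference

variable (N : ℕ)

/-- The vector `N^{-1/2} ∑ₖ cₖ |k⟩`, whose constant case `c = 1` is the reference vector. Reference
states evolve within this family. -/
def weightedRefVector (c : Fin N → ℂ) : EuclideanSpace ℂ (Fin N) :=
  (((√N)⁻¹ : ℝ) : ℂ) • ∑ k : Fin N, c k • EuclideanSpace.single k (1 : ℂ)

theorem weightedRefVector_one : weightedRefVector N (fun _ => 1) = refVector N := by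
  simp only [weightedRefVector, refVector, one_smul]

variable {N}

theorem weightedRefVector_apply (c : Fin N → ℂ) (k : Fin N) :
    weightedRefVector N c k = (((√N)⁻¹ : ℝ) : ℂ) * c k := by
  simp [weightedRefVector, Pi.single_apply]

theorem refVector_apply (k : Fin N) : refVector N k = (((√N)⁻¹ : ℝ) : ℂ) := by
  rw [← weightedRefVector_one, weightedRefVector_apply, mul_one]

theorem norm_refVector (hN : N ≠ 0) : ‖refVector N‖ = 1 := by
  rw [EuclideanSpace.norm_eq]
  simp [refVector_apply, hN]

theorem inner_refVector_weightedRefVector (c : Fin N → ℂ) :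
    ⟪refVector N, weightedRefVector N c⟫_ℂ = (N : ℂ)⁻¹ * ∑ k, c k := by
  have hsqrt : (((√N)⁻¹ : ℝ) : ℂ) * (((√N)⁻¹ : ℝ) : ℂ) = (N : ℂ)⁻¹ := by
    rw [← Complex.ofReal_mul, ← mul_inv, Real.mul_self_sqrt N.cast_nonneg, Complex.ofReal_inv,
      Complex.ofReal_natCast]
  rw [PiLp.inner_apply, Finset.mul_sum]
  refine Finset.sum_congr rfl fun k _ => ?_
  rw [refVector_apply, weightedRefVector_apply, RCLike.inner_apply,
    Complex.conj_ofReal, mul_right_comm, hsqrt]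

theorem refMeas_zero_weightedRefVector (c : Fin N → ℂ) :
    refMeas N 0 (weightedRefVector N c) = ((N : ℂ)⁻¹ * ∑ k, c k) • refVector N := by
  rw [← inner_refVector_weightedRefVector]
  rfl

theorem refMeas_one_apply (x : EuclideanSpace ℂ (Fin N)) :
    refMeas N 1 x = x - refMeas N 0 x := rfl

theorem norm_refMeas_zero_apply_le (hN : N ≠ 0) (x : EuclideanSpace ℂ (Fin N)) :
    ‖refMeas N 0 x‖ ≤ ‖x‖ := by
  have happly : refMeas N 0 x = ⟪refVector N, x⟫_ℂ • refVector N := rfl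
  rw [happly, norm_smul, norm_refVector hN, mul_one]
  exact (norm_inner_le_norm _ _).trans_eq (by rw [norm_refVector hN, one_mul])

theorem norm_refMeas_apply_le (hN : N ≠ 0) (a : Fin 2) (x : EuclideanSpace ℂ (Fin N)) :
    ‖refMeas N a x‖ ≤ 2 * ‖x‖ := by
  have hzero := norm_refMeas_zero_apply_le hN x
  rcases Fin.exists_fin_two.1 ⟨a, rfl⟩ with rfl | rfl
  · exact hzero.trans (by linarith [norm_nonneg x])
  · rw [refMeas_one_apply, two_mul]
    exact norm_sub_le_of_le le_rfl hzero

end Reference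

/-! ### Embeddings into tensor products -/

section Embedding

variable {E : Type*} [NormedAddCommGroup E] [InnerProductSpace ℂ E]

/-- The inclusion of the first summand into the Hilbert space direct sum `E ⊕ E`. -/
def prodInl : E →ₗᵢ[ℂ] WithLp 2 (E × E) where
  toLinearMap := (WithLp.linearEquiv 2 ℂ (E × E)).symm.toLinearMap ∘ₗ LinearMap.inl ℂ E E
  norm_map' x := by simp

/-- The inclusion of the second summand into the Hilbert space direct sum `E ⊕ E`. -/
def prodInr : E →ₗᵢ[ℂ] WithLp 2 (E × E) where
  toLinearMap := (WithLp.linearEquiv 2 ℂ (E × E)).symm.toLinearMap ∘ₗ LinearMap.inr ℂ E E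
  norm_map' x := by simp

theorem inner_prodInl_prodInr (x y : E) : ⟪prodInl x, prodInr y⟫_ℂ = 0 := by
  simp [prodInl, prodInr, WithLp.prod_inner_apply]

variable {P : Type*} [NormedAddCommGroup P] [InnerProductSpace ℂ P]

/-- The isometry `x ↦ v ⊗ x` defined by a unit vector `v`. -/
def tmulIsometry {v : P} (hv : ‖v‖ = 1) : E →ₗᵢ[ℂ] P ⊗[ℂ] E where
  toLinearMap := (TensorProduct.mkL ℂ P E v).toLinearMap
  norm_map' x := (TensorProduct.norm_tmul v x).trans (by rw [hv, one_mul])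

theorem inner_lTensor_prodInl_tmul_prodInr (z : P ⊗[ℂ] E) (v : P) (x : E) :
    ⟪LinearIsometry.lTensor P prodInl z, v ⊗ₜ[ℂ] prodInr x⟫_ℂ = 0 := by
  induction z using TensorProduct.induction_on with
  | zero => rw [map_zero, inner_zero_left]
  | tmul u y =>
    rw [LinearIsometry.lTensor_apply, LinearMap.lTensor_tmul, TensorProduct.inner_tmul]
    exact (congrArg (_ * ·) (inner_prodInl_prodInr y x)).trans (mul_zero _)
  | add z z' hz hz' => rw [map_add, inner_add_left, hz, hz', add_zero]

variable (P E) in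
/-- The operators `x ↦ v ⊗ (x, 0)`, as a function of `v`. -/
def tmulInl : P →L[ℂ] E →L[ℂ] P ⊗[ℂ] WithLp 2 (E × E) :=
  precomp _ prodInl.toContinuousLinearMap ∘L TensorProduct.mkL ℂ P (WithLp 2 (E × E))

theorem tmulInl_apply (v : P) (x : E) : tmulInl E P v x = v ⊗ₜ[ℂ] prodInl x := rfl

theorem norm_tmulInl_apply (v : P) (x : E) : ‖tmulInl E P v x‖ = ‖v‖ * ‖x‖ := by
  rw [tmulInl_apply, TensorProduct.norm_tmul, prodInl.norm_map]

theorem norm_tmulInl_le (v : P) : ‖tmulInl E P v‖ ≤ ‖v‖ :=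
  opNorm_le_bound _ (norm_nonneg v) fun x => (norm_tmulInl_apply v x).le

theorem norm_mkL_le (v : P) : ‖TensorProduct.mkL ℂ P E v‖ ≤ ‖v‖ :=
  opNorm_le_bound _ (norm_nonneg v) fun x => (TensorProduct.norm_tmul v x).le

end Embedding

/-! ### The self-testing isometry -/

section AmplifiedSums

variable {ι κ E F : Type*} [NormedAddCommGroup E] [InnerProductSpace ℂ E] [NormedAddCommGroup F]
  [InnerProductSpace ℂ F] [Fintype κ]

theorem dist_amp_comp_sum_smul_le (w : lp (fun _ : ι => E) 2) {P : κ → E →L[ℂ] E}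
    (hP : ∑ k, P k = 1) {S : E →L[ℂ] E} {c : κ → ℂ} (hc : ∀ k, ‖c k‖ ≤ 1) {σ : ℝ}
    (hS : ∀ k, dist (amp w (S * P k)) (amp w (c k • P k)) ≤ σ) {V : E →L[ℂ] F} (hV : ‖V‖ ≤ 1)
    {Y : κ → E →L[ℂ] F} {ε : ℝ} (hY : ∀ k, dist (amp w (V ∘L P k)) (amp w (Y k)) ≤ ε) :
    dist (amp w (V ∘L S)) (amp w (∑ k, c k • Y k)) ≤ Fintype.card κ * (σ + ε) := by
  have hterm : ∀ k, dist (amp w (V ∘L (S * P k))) (amp w (c k • Y k)) ≤ σ + ε := fun k => by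
    refine (dist_triangle _ (amp w (V ∘L (c k • P k))) _).trans (add_le_add ?_ ?_)
    · exact (dist_amp_comp_le w _ _ _).trans
        ((mul_le_of_le_one_left dist_nonneg hV).trans (hS k))
    · rw [comp_smul, map_smul, map_smul, dist_smul₀]
      exact (mul_le_of_le_one_left dist_nonneg (hc k)).trans (hY k)
  have hsum : V ∘L S = ∑ k, V ∘L (S * P k) := by
    rw [← comp_finsetSum, ← Finset.mul_sum, hP, mul_one]
  rw [hsum, map_sum, map_sum]
  refine (dist_sum_sum_le_of_le _ fun k _ => hterm k).trans_eq ?_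
  rw [Finset.sum_const, Finset.card_univ, nsmul_eq_mul]

end AmplifiedSums

section SelfTestIsometry

variable {ι E : Type*} [NormedAddCommGroup E] [InnerProductSpace ℂ E] {N : ℕ}

/-- The operator `√N ∑ₗ |l⟩ ⊗ M₀ Pₗ` with `Pₗ = phaseProj N U l`. It is approximately isometric when
`U` is nearly cyclic, since then `Pₗ M₀ Pₗ ≈ N⁻¹ Pₗ`. -/
def levelMap (N : ℕ) (U M₀ : E →L[ℂ] E) : E →L[ℂ] EuclideanSpace ℂ (Fin N) ⊗[ℂ] E :=
  (√N : ℂ) • ∑ l : Fin N,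
    TensorProduct.mkL ℂ (EuclideanSpace ℂ (Fin N)) E (EuclideanSpace.single l 1) ∘L
      (M₀ * phaseProj N U l)

variable [CompleteSpace E]

/-- The Cayley dilation of `levelMap`: an isometry which approximately maps `Pₗ w` to
`N^{-1/2} |l⟩ ⊗ w ⊕ 0`. -/
def selfTestIsometry (hN : N ≠ 0) (U M₀ : E →L[ℂ] E) :
    E →ₗᵢ[ℂ] EuclideanSpace ℂ (Fin N) ⊗[ℂ] WithLp 2 (E × E) :=
  cayleyIsometry (levelMap N U M₀) (J₁ := LinearIsometry.lTensor _ prodInl)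
    (J₂ := (tmulIsometry (norm_refVector hN)).comp prodInr)
    fun z => inner_lTensor_prodInl_tmul_prodInr z _

theorem adjoint_levelMap_comp_mkL (U M₀ : E →L[ℂ] E) (k : Fin N) :
    adjoint (levelMap N U M₀) ∘L
        TensorProduct.mkL ℂ (EuclideanSpace ℂ (Fin N)) E (EuclideanSpace.single k 1) =
      (√N : ℂ) • adjoint (M₀ * phaseProj N U k) := by
  ext x
  refine ext_inner_left ℂ fun y => ?_
  rw [comp_apply, adjoint_inner_right, smul_apply, inner_smul_right, adjoint_inner_right, levelMap,
    smul_apply, inner_smul_left, sum_apply, sum_inner, Finset.sum_eq_single k]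
  · simp [TensorProduct.inner_tmul]
  · intro l _ hl
    simp [TensorProduct.inner_tmul, EuclideanSpace.inner_single_left, hl]
  · simp

theorem sqrt_natCast_le (N : ℕ) : √(N : ℝ) ≤ N :=
  Real.sqrt_le_self_iff.2 (by
    rw [Nat.cast_eq_zero, Nat.one_le_cast]
    exact Nat.eq_zero_or_pos N)

namespace NearlyCyclic

variable {F : Type*} [NormedAddCommGroup F] [InnerProductSpace ℂ F] {w : lp (fun _ : ι => E) 2}
  {U M₀ : E →L[ℂ] E} {η ζ : ℝ}

theorem norm_levelMap_le (h : NearlyCyclic N w U M₀ η ζ) : ‖levelMap N U M₀‖ ≤ N ^ 2 := by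
  have hterm : ∀ l : Fin N,
      ‖TensorProduct.mkL ℂ (EuclideanSpace ℂ (Fin N)) E (EuclideanSpace.single l 1) ∘L
        (M₀ * phaseProj N U l)‖ ≤ 1 := fun l => by
    refine (opNorm_comp_le _ _).trans (mul_le_one₀ ?_ (norm_nonneg _) ?_)
    · exact (norm_mkL_le _).trans_eq (by simp)
    · exact (norm_mul_le _ _).trans (mul_le_one₀ h.norm_le (norm_nonneg _) (h.norm_phaseProj_le l))
  rw [levelMap, sq]
  refine (opNorm_smul_le _ _).trans (mul_le_mul ?_ ?_ (opNorm_nonneg _) N.cast_nonneg)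
  · rw [Complex.norm_real, Real.norm_of_nonneg (Real.sqrt_nonneg _)]
    exact sqrt_natCast_le N
  · exact (norm_sum_le_of_le _ fun l _ => hterm l).trans_eq (by simp)

theorem dist_amp_sum_comp_mul_phaseProj_le (h : NearlyCyclic N w U M₀ η ζ) {e : Fin N → E →L[ℂ] F}
    (he : ∀ l, ‖e l‖ ≤ 1) (k : Fin N) :
    dist (amp w (∑ l, e l ∘L (M₀ * (phaseProj N U l * phaseProj N U k))))
      (amp w ((N : ℂ)⁻¹ • e k)) ≤ N * ζ + η := by
  have hoff : ∀ l, dist (amp w (e l ∘L (M₀ * (phaseProj N U l * phaseProj N U k))))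
      (amp w (e l ∘L (M₀ * (if l = k then (1 : ℂ) else 0) • phaseProj N U k))) ≤ ζ := fun l => by
    refine (dist_amp_comp_le w _ _ _).trans ((mul_le_of_le_one_left dist_nonneg (he l)).trans ?_)
    exact (dist_amp_comp_le w M₀ _ _).trans ((mul_le_of_le_one_left dist_nonneg h.norm_le).trans
      (h.dist_amp_phaseProj_mul_phaseProj_le l k))
  have hdiag : dist (amp w (e k ∘L (M₀ * phaseProj N U k))) (amp w (e k ∘L ((N : ℂ)⁻¹ • 1))) ≤ η :=
    (dist_amp_comp_le w _ _ _).trans ((mul_le_of_le_one_left dist_nonneg (he k)).trans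
      (h.dist_amp_mul_phaseProj_le k))
  have hcollapse : e k ∘L (M₀ * phaseProj N U k) =
      ∑ l, e l ∘L (M₀ * (if l = k then (1 : ℂ) else 0) • phaseProj N U k) := by
    rw [Finset.sum_eq_single k (fun l _ hl => by simp [hl]) (by simp), if_pos rfl, one_smul]
  rw [comp_smul] at hdiag
  refine (dist_triangle _ _ _).trans (add_le_add ?_ hdiag)
  rw [hcollapse, map_sum, map_sum]
  exact (dist_sum_sum_le_of_le _ fun l _ => hoff l).trans_eq (by simp)

theorem dist_amp_levelMap_comp_phaseProj_le (h : NearlyCyclic N w U M₀ η ζ) (k : Fin N) :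
    dist (amp w (levelMap N U M₀ ∘L phaseProj N U k))
      (amp w (TensorProduct.mkL ℂ _ E ((((√N)⁻¹ : ℝ) : ℂ) • EuclideanSpace.single k 1))) ≤
      N ^ 2 * (ζ + η) := by
  set e : Fin N → E →L[ℂ] EuclideanSpace ℂ (Fin N) ⊗[ℂ] E :=
    fun l => TensorProduct.mkL ℂ _ E (EuclideanSpace.single l 1)
  have he : ∀ l, ‖e l‖ ≤ 1 := fun l => (norm_mkL_le _).trans_eq (by simp)
  have hcompose : levelMap N U M₀ ∘L phaseProj N U k =
      (√N : ℂ) • ∑ l, e l ∘L (M₀ * (phaseProj N U l * phaseProj N U k)) := by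
    rw [levelMap, smul_comp, finsetSum_comp]
    rfl
  have hscalar : (((√N)⁻¹ : ℝ) : ℂ) = (√N : ℂ) * (N : ℂ)⁻¹ := by
    rw [← Complex.ofReal_natCast, ← Complex.ofReal_inv, ← Complex.ofReal_mul, ← div_eq_mul_inv,
      Real.sqrt_div_self]
  rw [hcompose, hscalar, mul_smul, map_smul, map_smul, map_smul, map_smul, dist_smul₀,
    Complex.norm_real, Real.norm_of_nonneg (Real.sqrt_nonneg _)]
  have hN := h.one_le_cast
  have hη := h.eta_nonneg
  calc √N * dist _ _ ≤ N * (N * ζ + 1 * η) := by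
        rw [one_mul]
        exact mul_le_mul (sqrt_natCast_le N) (h.dist_amp_sum_comp_mul_phaseProj_le he k)
          dist_nonneg N.cast_nonneg
    _ ≤ N * (N * ζ + N * η) := by gcongr
    _ = N ^ 2 * (ζ + η) := by ring

theorem dist_amp_adjoint_levelMap_comp_le (h : NearlyCyclic N w U M₀ η ζ) (k : Fin N) :
    dist (amp w (adjoint (levelMap N U M₀) ∘L
        TensorProduct.mkL ℂ _ E ((((√N)⁻¹ : ℝ) : ℂ) • EuclideanSpace.single k 1)))
      (amp w (phaseProj N U k)) ≤ 2 * (ζ + η) := by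
  have hsqrt : (((√N)⁻¹ : ℝ) : ℂ) * (√N : ℂ) = 1 := by
    rw [← Complex.ofReal_mul, inv_mul_cancel₀ (by have := h.ne_zero; positivity),
      Complex.ofReal_one]
  have hadjoint : adjoint (M₀ * phaseProj N U k) = adjoint (phaseProj N U k) ∘L M₀ := by
    rw [← star_eq_adjoint, star_mul, h.isSelfAdjoint.star_eq]
    rfl
  rw [map_smul, comp_smul, adjoint_levelMap_comp_mkL, smul_smul, hsqrt, one_smul, hadjoint]
  have hmeas : dist (amp w (adjoint (phaseProj N U k) ∘L M₀))
      (amp w (adjoint (phaseProj N U k) ∘L 1)) ≤ η := by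
    refine (dist_amp_comp_le w _ _ _).trans
      ((mul_le_of_le_one_left dist_nonneg (h.norm_adjoint_phaseProj_le k)).trans ?_)
    rw [dist_comm, dist_amp]
    exact h.norm_amp_one_sub
  refine (dist_triangle _ _ _).trans
    ((add_le_add hmeas (h.dist_amp_adjoint_phaseProj_le k)).trans ?_)
  linarith [h.eta_nonneg]

theorem dist_amp_selfTestIsometry_comp_phaseProj_le (h : NearlyCyclic N w U M₀ η ζ)
    (k : Fin N) :
    dist (amp w ((selfTestIsometry h.ne_zero U M₀).toContinuousLinearMap ∘L phaseProj N U k))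
      (amp w (tmulInl E _ ((((√N)⁻¹ : ℝ) : ℂ) • EuclideanSpace.single k 1))) ≤
      7 * N ^ 6 * (ζ + η) := by
  have hN := h.one_le_cast
  have hε : 0 ≤ ζ + η := add_nonneg h.zeta_nonneg h.eta_nonneg
  have hnorm := h.norm_levelMap_le
  refine (dist_amp_cayleyIsometry_comp_le _ _ (h.dist_amp_levelMap_comp_phaseProj_le k)
    (h.dist_amp_adjoint_levelMap_comp_le k)).trans ?_
  calc N ^ 2 * (ζ + η) + (‖levelMap N U M₀‖ + 1) *
        (2 * (ζ + η) + ‖levelMap N U M₀‖ * (N ^ 2 * (ζ + η)))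
      ≤ N ^ 2 * (ζ + η) + (N ^ 2 + N ^ 2) *
        (2 * (ζ + η) + N ^ 2 * (N ^ 2 * (ζ + η))) := by
        gcongr
        exact one_le_pow₀ hN
    _ = (5 * N ^ 2 + 2 * N ^ 6) * (ζ + η) := by ring
    _ ≤ (5 * N ^ 6 + 2 * N ^ 6) * (ζ + η) := by
        gcongr
        · norm_num
    _ = _ := by ring

end NearlyCyclic

end SelfTestIsometry

section ApproximateIntertwining

variable {ι E : Type*} [NormedAddCommGroup E] [InnerProductSpace ℂ E] [CompleteSpace E] {N : ℕ}
  {w : lp (fun _ : ι => E) 2} {U S : E →L[ℂ] E} {η ζ σ : ℝ} {c : Fin N → ℂ}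

theorem norm_inv_natCast_mul_sum_le_one (hc : ∀ k, ‖c k‖ ≤ 1) : ‖(N : ℂ)⁻¹ * ∑ k, c k‖ ≤ 1 := by
  rw [norm_mul, norm_inv, Complex.norm_natCast]
  refine inv_mul_le_one_of_le₀ ?_ N.cast_nonneg
  exact (norm_sum_le_of_le _ fun k _ => hc k).trans_eq (by simp)

namespace NearlyCyclic

theorem dist_amp_selfTestIsometry_comp_le {M₀ : E →L[ℂ] E} (h : NearlyCyclic N w U M₀ η ζ)
    (hc : ∀ k, ‖c k‖ ≤ 1)
    (hS : ∀ k : Fin N, dist (amp w (S * phaseProj N U k)) (amp w (c k • phaseProj N U k)) ≤ σ) :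
    dist (amp w ((selfTestIsometry h.ne_zero U M₀).toContinuousLinearMap ∘L S))
      (amp w (tmulInl E _ (weightedRefVector N c))) ≤ N * (σ + 7 * N ^ 6 * (ζ + η)) := by
  have hweighted : tmulInl E _ (weightedRefVector N c) =
      ∑ k, c k • tmulInl E _ ((((√N)⁻¹ : ℝ) : ℂ) • EuclideanSpace.single k 1) := by
    simp only [weightedRefVector, Finset.smul_sum, map_sum, map_smul, smul_comm (c _)]
  rw [hweighted]
  exact (dist_amp_comp_sum_smul_le w (sum_phaseProj h.ne_zero U) hc hS
    (LinearIsometry.norm_toContinuousLinearMap_le _)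
    h.dist_amp_selfTestIsometry_comp_phaseProj_le).trans_eq (by rw [Fintype.card_fin])

theorem dist_amp_mul_le {M₀ : E →L[ℂ] E} (h : NearlyCyclic N w U M₀ η ζ) (hc : ∀ k, ‖c k‖ ≤ 1)
    (hS : ∀ k : Fin N, dist (amp w (S * phaseProj N U k)) (amp w (c k • phaseProj N U k)) ≤ σ) :
    dist (amp w (M₀ * S)) (amp w (((N : ℂ)⁻¹ * ∑ k, c k) • 1)) ≤ N * (σ + η) := by
  have hmean : ((N : ℂ)⁻¹ * ∑ k, c k) • (1 : E →L[ℂ] E) = ∑ k, c k • (N : ℂ)⁻¹ • 1 := by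
    rw [mul_comm, mul_smul, Finset.sum_smul]
  rw [hmean]
  exact (dist_amp_comp_sum_smul_le w (sum_phaseProj h.ne_zero U) hc hS h.norm_le
    fun k : Fin N => h.dist_amp_mul_phaseProj_le k).trans_eq (by rw [Fintype.card_fin])

theorem dist_amp_selfTestIsometry_comp_mul_le {M₀ : E →L[ℂ] E} (h : NearlyCyclic N w U M₀ η ζ)
    (hc : ∀ k, ‖c k‖ ≤ 1)
    (hS : ∀ k : Fin N, dist (amp w (S * phaseProj N U k)) (amp w (c k • phaseProj N U k)) ≤ σ) :
    dist (amp w ((selfTestIsometry h.ne_zero U M₀).toContinuousLinearMap ∘L (M₀ * S)))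
      (amp w (tmulInl E _ (refMeas N 0 (weightedRefVector N c)))) ≤
      N * (σ + η) + 7 * N ^ 7 * (ζ + η) := by
  set V := selfTestIsometry h.ne_zero U M₀
  set m := (N : ℂ)⁻¹ * ∑ k, c k
  have hmeas : dist (amp w (V.toContinuousLinearMap ∘L (M₀ * S)))
      (amp w (V.toContinuousLinearMap ∘L (m • 1))) ≤ N * (σ + η) :=
    (dist_amp_comp_le w _ _ _).trans ((mul_le_of_le_one_left dist_nonneg
      V.norm_toContinuousLinearMap_le).trans (h.dist_amp_mul_le hc hS))
  have hone : dist (amp w (V.toContinuousLinearMap ∘L 1)) (amp w (tmulInl E _ (refVector N))) ≤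
      7 * N ^ 7 * (ζ + η) := by
    rw [← weightedRefVector_one]
    refine (h.dist_amp_selfTestIsometry_comp_le (σ := 0) (fun _ => norm_one.le)
      fun k => ?_).trans_eq (by ring)
    rw [one_mul, one_smul, dist_self]
  rw [refMeas_zero_weightedRefVector]
  refine (dist_triangle _ _ _).trans (add_le_add hmeas ?_)
  rw [comp_smul, map_smul, map_smul, map_smul, dist_smul₀]
  exact (mul_le_of_le_one_left dist_nonneg (norm_inv_natCast_mul_sum_le_one hc)).trans hone

theorem dist_amp_selfTestIsometry_comp_meas_mul_le {M : Fin 2 → E →L[ℂ] E}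
    (hM : ∑ a, M a = 1) (h : NearlyCyclic N w U (M 0) η ζ) (hc : ∀ k, ‖c k‖ ≤ 1)
    (hS : ∀ k : Fin N, dist (amp w (S * phaseProj N U k)) (amp w (c k • phaseProj N U k)) ≤ σ)
    (a : Fin 2) :
    dist (amp w ((selfTestIsometry h.ne_zero U (M 0)).toContinuousLinearMap ∘L (M a * S)))
      (amp w (tmulInl E _ (refMeas N a (weightedRefVector N c)))) ≤
      2 * N * σ + 15 * N ^ 7 * (ζ + η) := by
  have hall := h.dist_amp_selfTestIsometry_comp_le hc hS
  have hzero := h.dist_amp_selfTestIsometry_comp_mul_le hc hS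
  have hσ : 0 ≤ N * σ :=
    mul_nonneg N.cast_nonneg (dist_nonneg.trans (hS ⟨0, Nat.pos_of_ne_zero h.ne_zero⟩))
  have hε : 0 ≤ N ^ 7 * (ζ + η) :=
    mul_nonneg (by positivity) (add_nonneg h.zeta_nonneg h.eta_nonneg)
  have hη : N * η ≤ N ^ 7 * (ζ + η) := by
    have := h.eta_nonneg
    gcongr
    · exact le_self_pow₀ h.one_le_cast (by norm_num)
    · exact le_add_of_nonneg_left h.zeta_nonneg
  rcases Fin.exists_fin_two.1 ⟨a, rfl⟩ with rfl | rfl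
  · linarith
  · rw [Fin.sum_univ_two, ← eq_sub_iff_add_eq'] at hM
    rw [hM, sub_mul, one_mul, comp_sub, map_sub, refMeas_one_apply, map_sub, map_sub]
    refine (dist_sub_sub_le _ _ _ _).trans ?_
    linarith

end NearlyCyclic

end ApproximateIntertwining

/-! ### Time steps and energy levels -/

section TimeSteps

/-- The spacing `2π(N-1)/(NΛ)` of the times at which the dataset is recorded. -/
def timeStep (N : ℕ) (Λ : ℝ) : ℝ := 2 * Real.pi * ((N : ℝ) - 1) / ((N : ℝ) * Λ)

/-- The eigenvalues `Λk/(N-1)` of the reference Hamiltonian. -/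
def energyLevel (N : ℕ) (Λ : ℝ) (k : ℕ) : ℝ := Λ / ((N : ℝ) - 1) * k

/-- The phase `e^{-itEₖ}` acquired after time `t` at the energy level `Eₖ`. -/
def energyPhase (N : ℕ) (Λ t : ℝ) (k : ℕ) : ℂ :=
  Complex.exp (-(Complex.I * ((t * energyLevel N Λ k : ℝ) : ℂ)))

variable {N : ℕ} {Λ : ℝ}

theorem dataTime_eq (j : Fin N) : dataTime N Λ j = (j : ℕ) * timeStep N Λ := by
  unfold dataTime timeStep
  ring

theorem natCast_sub_one_pos (hN : 2 ≤ N) : (0 : ℝ) < N - 1 :=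
  sub_pos.2 (Nat.one_lt_cast.2 hN)

theorem timeStep_pos (hN : 2 ≤ N) (hΛ : 0 < Λ) : 0 < timeStep N Λ := by
  have := natCast_sub_one_pos hN
  unfold timeStep
  positivity

theorem timeStep_mul (hN : N ≠ 0) (hΛ : Λ ≠ 0) :
    timeStep N Λ * Λ = 2 * Real.pi - 2 * (Real.pi / N) := by
  unfold timeStep
  field_simp

theorem energyLevel_mem_Icc (hΛ : 0 ≤ Λ) (k : Fin N) :
    energyLevel N Λ k ∈ Set.Icc 0 Λ := by
  have hk : ((k : ℕ) : ℝ) ≤ N - 1 := by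
    rw [le_sub_iff_add_le]
    exact_mod_cast k.2
  have hN : (0 : ℝ) ≤ N - 1 := (Nat.cast_nonneg _).trans hk
  refine ⟨mul_nonneg (div_nonneg hΛ hN) (Nat.cast_nonneg _), ?_⟩
  rw [energyLevel, div_mul_eq_mul_div]
  exact div_le_of_le_mul₀ hN hΛ (mul_le_mul_of_nonneg_left hk hΛ)

theorem norm_energyPhase (t : ℝ) (k : ℕ) : ‖energyPhase N Λ t k‖ = 1 := norm_exp_neg_I_mul _

theorem energyPhase_timeStep (hN : 2 ≤ N) (hΛ : Λ ≠ 0) (k : ℕ) :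
    energyPhase N Λ (timeStep N Λ) k = (unityRoot N ^ k)⁻¹ := by
  have hmul : timeStep N Λ * energyLevel N Λ k = 2 * Real.pi * k / N := by
    have := (natCast_sub_one_pos hN).ne'
    unfold timeStep energyLevel
    field_simp
  rw [energyPhase, hmul, unityRoot, ← Complex.exp_nat_mul, ← Complex.exp_neg]
  congr 1
  push_cast
  ring

end TimeSteps

/-! ### The reference dynamics -/

section ReferenceDynamics

theorem exp_apply_of_eigenvector {F : Type*} [NormedAddCommGroup F] [NormedSpace ℂ F]
    [CompleteSpace F] {A : F →L[ℂ] F} {v : F} {μ : ℂ} (h : A v = μ • v) :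
    NormedSpace.exp A v = Complex.exp μ • v := by
  have hpow : ∀ n : ℕ, (A ^ n) v = μ ^ n • v := fun n => by
    induction n with
    | zero => simp
    | succ n ih => rw [pow_succ, mul_apply_eq_comp, h, map_smul, ih, smul_smul, pow_succ, mul_comm]
  have hA := (NormedSpace.exp_series_hasSum_exp' (𝕂 := ℂ) A).mapL (ContinuousLinearMap.apply ℂ F v)
  have hμ := (NormedSpace.exp_series_hasSum_exp' (𝕂 := ℂ) μ).smul_const v
  rw [← Complex.exp_eq_exp_ℂ] at hμ
  refine hA.unique (hμ.congr_fun fun n => ?_)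
  rw [apply_apply, smul_apply, hpow, smul_assoc]

variable {F : Type*} [NormedAddCommGroup F] [InnerProductSpace ℂ F] [CompleteSpace F]

theorem isSelfAdjoint_proj (ψ : F) : IsSelfAdjoint (proj ψ) :=
  InnerProductSpace.adjoint_rankOne ψ ψ

theorem mul_evolve_proj {H : F →L[ℂ] F} (hH : IsSelfAdjoint H) (M : F →L[ℂ] F) (ψ : F) (t : ℝ) :
    M * evolve H (proj ψ) t =
      InnerProductSpace.rankOne ℂ (M (propagator H t ψ)) (propagator H t ψ) := by
  ext x
  rw [evolve_eq_comp hH, InnerProductSpace.rankOne_apply, ← adjoint_inner_right, ← map_smul,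
    ← map_smul]
  rfl

variable (N : ℕ) (Λ t : ℝ)

theorem isSelfAdjoint_refHamiltonian : IsSelfAdjoint (refHamiltonian N Λ) :=
  IsSelfAdjoint.smul (Complex.conj_ofReal _) <| (map_sum _ _ _).trans <|
    Finset.sum_congr rfl fun _ _ =>
      IsSelfAdjoint.smul (Complex.conj_natCast _) (isSelfAdjoint_proj _)

theorem refHamiltonian_single (k : Fin N) :
    refHamiltonian N Λ (EuclideanSpace.single k 1) =
      (energyLevel N Λ k : ℂ) • EuclideanSpace.single k 1 := by
  have hproj : ∀ l, proj (EuclideanSpace.single l (1 : ℂ)) (EuclideanSpace.single k 1) =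
      if l = k then EuclideanSpace.single k (1 : ℂ) else 0 := fun l => by
    rw [proj, InnerProductSpace.rankOne_apply, EuclideanSpace.inner_single_left]
    split_ifs with hl <;> simp [hl]
  simp [refHamiltonian, energyLevel, sum_apply, hproj, smul_smul]

theorem propagator_refHamiltonian_single (k : Fin N) :
    propagator (refHamiltonian N Λ) t (EuclideanSpace.single k 1) =
      energyPhase N Λ t k • EuclideanSpace.single k 1 := by
  refine exp_apply_of_eigenvector ?_
  rw [smul_apply, refHamiltonian_single, smul_smul]
  congr 1
  push_cast
  ring

theorem propagator_refHamiltonian_refVector :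
    propagator (refHamiltonian N Λ) t (refVector N) =
      weightedRefVector N fun k => energyPhase N Λ t k := by
  simp only [refVector, weightedRefVector, map_smul, map_sum, propagator_refHamiltonian_single]

end ReferenceDynamics

section TensorProduct

variable {E P : Type*} [NormedAddCommGroup E] [InnerProductSpace ℂ E] [CompleteSpace E]
  [NormedAddCommGroup P] [InnerProductSpace ℂ P] [CompleteSpace (P ⊗[ℂ] WithLp 2 (E × E))]

theorem adjoint_tmulInl_tmul (v x : P) (y : WithLp 2 (E × E)) :
    adjoint (tmulInl E P v) (x ⊗ₜ[ℂ] y) =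
      ⟪v, x⟫_ℂ • adjoint prodInl.toContinuousLinearMap y := by
  refine ext_inner_left ℂ fun z => ?_
  rw [adjoint_inner_right, inner_smul_right, adjoint_inner_right, tmulInl_apply,
    TensorProduct.inner_tmul]
  rfl

theorem mapL_rankOne_conjIsometry_prodInl (ρ : E →L[ℂ] E) (v v' : P) :
    TensorProduct.mapL (InnerProductSpace.rankOne ℂ v v') (conjIsometry prodInl ρ) =
      tmulInl E P v ∘L ρ ∘L adjoint (tmulInl E P v') := by
  ext z
  induction z using TensorProduct.induction_on with
  | zero => rw [map_zero, map_zero]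
  | tmul x y =>
    rw [TensorProduct.mapL_tmul, InnerProductSpace.rankOne_apply, comp_apply (tmulInl E P v),
      comp_apply ρ, adjoint_tmulInl_tmul, map_smul, map_smul, ← TensorProduct.smul_tmul']
    rfl
  | add z z' hz hz' => rw [map_add, map_add, hz, hz']

end TensorProduct

/-! ### Drift of the phases -/

section PhaseDrift

variable {N : ℕ} {Λ : ℝ}

/-- How far apart the phases of two energies in `[0, Λ]` can drift per unit of time, relative to
their distance after a single time step. -/
def driftRate (N : ℕ) (Λ : ℝ) : ℝ := Real.pi / (timeStep N Λ * Real.sin (Real.pi / N))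

theorem driftRate_nonneg (hN : 2 ≤ N) (hΛ : 0 < Λ) : 0 ≤ driftRate N Λ := by
  have := timeStep_pos hN hΛ
  have := sin_pi_div_pos hN
  unfold driftRate
  positivity

namespace NearlyCyclic

variable {ι E : Type*} [NormedAddCommGroup E] [InnerProductSpace ℂ E] [CompleteSpace E]
  {w : lp (fun _ : ι => E) 2} {U M₀ : E →L[ℂ] E} {η ζ : ℝ}

theorem norm_amp_sub_mul_phaseProj_le (h : NearlyCyclic N w U M₀ η ζ) (k : ℕ) :
    ‖amp w ((U - (unityRoot N ^ k)⁻¹ • 1) * phaseProj N U k)‖ ≤ ζ := by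
  have hne : unityRoot N ^ k ≠ 0 :=
    pow_ne_zero _ ((isPrimitiveRoot_unityRoot h.ne_zero).ne_zero h.ne_zero)
  have hdefect : (U - (unityRoot N ^ k)⁻¹ • 1) * phaseProj N U k =
      ((unityRoot N ^ k)⁻¹ * (N : ℂ)⁻¹) • (U ^ N - 1) := by
    rw [mul_smul, ← unityRoot_pow_smul_pow_self h.ne_zero k U, ← sub_one_mul_powerAverage,
      ← smul_mul_assoc, smul_sub, inv_smul_smul₀ hne, phaseProj]
  rw [hdefect, map_smul, norm_smul, norm_mul, norm_inv, norm_pow, norm_unityRoot h.ne_zero,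
    one_pow, inv_one, one_mul, norm_inv, Complex.norm_natCast]
  exact (mul_le_of_le_one_left (norm_nonneg _) (inv_le_one_of_one_le₀ h.one_le_cast)).trans
    h.norm_amp_pow_sub_one

theorem dist_amp_propagator_mul_phaseProj_le {H : E →L[ℂ] E} (hN : 2 ≤ N) (hΛ : 0 < Λ)
    (hH : IsSelfAdjoint H) (hs : spectrum ℝ H ⊆ Set.Icc 0 Λ)
    (h : NearlyCyclic N w (propagator H (timeStep N Λ)) M₀ η ζ) (t : ℝ) (k : Fin N) :
    dist (amp w (propagator H t * phaseProj N (propagator H (timeStep N Λ)) k))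
      (amp w (energyPhase N Λ t k • phaseProj N (propagator H (timeStep N Λ)) k)) ≤
      |t| * driftRate N Λ * ζ := by
  set U := propagator H (timeStep N Λ)
  have hdrift : 0 ≤ |t| * driftRate N Λ := mul_nonneg (abs_nonneg t) (driftRate_nonneg hN hΛ)
  have hpi : Real.pi / N ≤ Real.pi / 2 :=
    div_le_div_of_nonneg_left Real.pi_pos.le two_pos (Nat.ofNat_le_cast.2 hN)
  have happly : ∀ y, ‖(propagator H t - energyPhase N Λ t k • 1) y‖ ≤
      |t| * driftRate N Λ * ‖(U - (unityRoot N ^ (k : ℕ))⁻¹ • 1) y‖ := fun y => by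
    rw [← energyPhase_timeStep hN hΛ.ne']
    exact norm_propagator_sub_apply_le hH hs (by positivity) hpi (timeStep_pos hN hΛ)
      (timeStep_mul h.ne_zero hΛ.ne').le (energyLevel_mem_Icc hΛ.le k) t y
  have hmono : ‖amp w ((propagator H t - energyPhase N Λ t k • 1) * phaseProj N U k)‖ ≤
      ‖amp w (((|t| * driftRate N Λ : ℝ) : ℂ) •
        ((U - (unityRoot N ^ (k : ℕ))⁻¹ • 1) * phaseProj N U k))‖ := by
    refine norm_amp_mono w fun x => (happly (phaseProj N U k x)).trans_eq ?_
    rw [smul_apply, norm_smul, Complex.norm_real, Real.norm_of_nonneg hdrift]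
    rfl
  rw [map_smul, norm_smul, Complex.norm_real, Real.norm_of_nonneg hdrift] at hmono
  rw [dist_amp, ← smul_one_mul (energyPhase N Λ t k), ← sub_mul]
  exact hmono.trans (mul_le_mul_of_nonneg_left (h.norm_amp_sub_mul_phaseProj_le k) hdrift)

end NearlyCyclic

end PhaseDrift

/-! ### Realizations that fit the dataset -/

namespace Realization

section Timeline

variable {𝓗 : Type u} [NormedAddCommGroup 𝓗] [InnerProductSpace ℂ 𝓗] [CompleteSpace 𝓗]
  {A : Type v} [Fintype A] (R : Realization 𝓗 A)

theorem meas_nonneg (a : A) : 0 ≤ R.meas a :=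
  (nonneg_iff_isPositive _).2 (R.isPositive_meas a)

theorem meas_le_one (a : A) : R.meas a ≤ 1 :=
  (Finset.single_le_sum (fun b _ => R.meas_nonneg b) (Finset.mem_univ a)).trans_eq R.sum_meas

theorem norm_meas_le_one (a : A) : ‖R.meas a‖ ≤ 1 :=
  (CStarAlgebra.norm_le_one_iff_of_nonneg _ (R.meas_nonneg a)).2 (R.meas_le_one a)

theorem adjoint_meas (a : A) : adjoint (R.meas a) = R.meas a :=
  (R.isPositive_meas a).isSelfAdjoint

theorem norm_meas_apply_sq_le (a : A) (x : 𝓗) :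
    ‖R.meas a x‖ ^ 2 ≤ (⟪x, R.meas a x⟫_ℂ).re := by
  have hsq : R.meas a ^ 2 ≤ R.meas a ^ 1 :=
    CStarAlgebra.pow_antitone (R.meas_nonneg a) (R.meas_le_one a) one_le_two
  have hpos := ((le_def _ _).1 hsq).re_inner_nonneg_right x
  have hinner : ⟪x, R.meas a (R.meas a x)⟫_ℂ = ((‖R.meas a x‖ ^ 2 : ℝ) : ℂ) := by
    rw [← adjoint_inner_left, adjoint_meas, inner_self_eq_norm_sq_to_K]
    norm_cast
  rwa [pow_one, sq, sub_apply, inner_sub_right, mul_apply_eq_comp, hinner, map_sub, sub_nonneg,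
    RCLike.re_eq_complex_re, Complex.ofReal_re] at hpos

theorem norm_amp_meas_mul_propagator_sq_le (a : A) (t : ℝ) :
    ‖amp R.isDensityOperator_state.purification (R.meas a * propagator R.hamiltonian t)‖ ^ 2 ≤
      R.timeline a t := by
  set U := propagator R.hamiltonian t
  have htimeline : evolve R.hamiltonian R.state t * R.meas a =
      U ∘L R.state ∘L adjoint (R.meas a ∘L U) := by
    rw [evolve_eq_comp R.isSelfAdjoint_hamiltonian, adjoint_comp, adjoint_meas]
    rfl
  rw [timeline, htimeline, R.isDensityOperator_state.trace_comp_comp_adjoint,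
    inner_amp_eq_inner_amp_adjoint_comp,
    adjoint_comp, adjoint_meas]
  refine norm_amp_sq_le_re_inner_amp _ fun x => ?_
  rw [comp_apply _ U, comp_apply, adjoint_inner_right]
  exact R.norm_meas_apply_sq_le a (U x)

end Timeline

end Realization

theorem norm_inner_amp_le_add {ι E : Type*} [NormedAddCommGroup E] [InnerProductSpace ℂ E]
    [CompleteSpace E] {w : lp (fun _ : ι => E) 2} (hw : ‖w‖ ≤ 1) {M X : E →L[ℂ] E}
    (hM : adjoint M = M) (hX : ‖X‖ ≤ 1) :
    ‖⟪w, amp w X⟫_ℂ‖ ≤ ‖amp w (1 - M)‖ + ‖amp w (M * X)‖ := by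
  have hsplit : ⟪w, amp w X⟫_ℂ = ⟪amp w (1 - M), amp w X⟫_ℂ + ⟪w, amp w (M * X)⟫_ℂ := by
    have hadjoint : adjoint (1 - M) = 1 - M := by
      rw [map_sub, hM, ← star_eq_adjoint, star_one]
    rw [inner_amp_eq_inner_amp_adjoint_comp, hadjoint, ← inner_add_right, ← map_add, ← mul_def,
      ← add_mul, sub_add_cancel, one_mul]
  rw [hsplit]
  refine norm_add_le_of_le ?_ ?_
  · exact (norm_inner_le_norm _ _).trans (mul_le_of_le_one_right (norm_nonneg _)
      ((norm_amp_le w X).trans (mul_le_one₀ hX (norm_nonneg _) hw)))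
  · exact (norm_inner_le_norm _ _).trans (mul_le_of_le_one_left (norm_nonneg _) hw)

section Fits

variable {𝓗 : Type u} [NormedAddCommGroup 𝓗] [InnerProductSpace ℂ 𝓗] [CompleteSpace 𝓗]
  {N : ℕ} {Λ δ : ℝ}

theorem Fits.norm_amp_meas_mul_propagator_pow_le {R : Realization 𝓗 (Fin 2)}
    (hfit : Fits N Λ δ R.timeline) {a : Fin 2} {j : Fin N} (ha : dataset N a j = 0) :
    ‖amp R.isDensityOperator_state.purification
      (R.meas a * propagator R.hamiltonian (timeStep N Λ) ^ (j : ℕ))‖ ≤ √(min 1 δ) := by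
  have hterm := (Finset.single_le_sum (fun _ _ => abs_nonneg _) (Finset.mem_univ a)).trans (hfit j)
  rw [ha, sub_zero] at hterm
  rw [propagator_pow, ← dataTime_eq]
  refine Real.le_sqrt_of_sq_le (le_min (pow_le_one₀ (norm_nonneg _) ?_) ?_)
  · refine (R.isDensityOperator_state.norm_amp_purification_le _).trans ((norm_mul_le _ _).trans ?_)
    exact mul_le_one₀ (R.norm_meas_le_one a) (norm_nonneg _)
      (norm_propagator_le R.isSelfAdjoint_hamiltonian _)
  · exact (R.norm_amp_meas_mul_propagator_sq_le a _).trans ((le_abs_self _).trans hterm)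

theorem Fits.nonneg {P : Fin 2 → ℝ → ℝ} (hN : N ≠ 0) (hfit : Fits N Λ δ P) : 0 ≤ δ :=
  (Finset.sum_nonneg fun _ _ => abs_nonneg _).trans (hfit ⟨0, Nat.pos_of_ne_zero hN⟩)

/-- The constant relating the error in `U ^ N ≈ 1` to the fourth root of the error of the fit. -/
def cycleConst (N : ℕ) : ℝ := √(16 * N / Real.sin (Real.pi / N))

theorem Fits.nearlyCyclic {R : Realization 𝓗 (Fin 2)} (hN : 2 ≤ N) (hΛ : 0 < Λ)
    (hs : R.HardSupport Λ) (hfit : Fits N Λ δ R.timeline) :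
    NearlyCyclic N R.isDensityOperator_state.purification
      (propagator R.hamiltonian (timeStep N Λ)) (R.meas 0) √(min 1 δ)
      (cycleConst N * √√(min 1 δ)) := by
  have hN0 : 0 < N := two_pos.trans_le hN
  have hH := R.isSelfAdjoint_hamiltonian
  have hU := propagator_mem_unitary hH (timeStep N Λ)
  have hsin := sin_pi_div_pos hN
  set w := R.isDensityOperator_state.purification
  have hone : ‖amp w (1 - R.meas 0)‖ ≤ √(min 1 δ) := by
    rw [← R.sum_meas, Fin.sum_univ_two, add_sub_cancel_left, ← mul_one (R.meas 1),
      ← pow_zero (propagator R.hamiltonian (timeStep N Λ))]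
    exact hfit.norm_amp_meas_mul_propagator_pow_le (j := ⟨0, hN0⟩) (by simp [dataset])
  have hzero : ∀ j, 0 < j → j < N →
      ‖amp w (R.meas 0 * propagator R.hamiltonian (timeStep N Λ) ^ j)‖ ≤ √(min 1 δ) :=
    fun j hj hjN => hfit.norm_amp_meas_mul_propagator_pow_le (j := ⟨j, hjN⟩)
      (by simp [dataset, hj.ne'])
  refine ⟨hN0.ne', (Unitary.mem_iff.1 hU).1, (R.isPositive_meas 0).isSelfAdjoint,
    R.norm_meas_le_one 0, hone, hzero, ?_⟩
  rw [cycleConst, ← Real.sqrt_mul (by positivity)]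
  refine Real.le_sqrt_of_sq_le ((norm_amp_propagator_pow_sub_one_sq_le hN hH hs
    (timeStep_pos hN hΛ).le (timeStep_mul hN0.ne' hΛ.ne').le w (η := 2 * √(min 1 δ))
    fun j hj hjN => ?_).trans_eq (by ring))
  rw [two_mul]
  refine (norm_inner_amp_le_add R.isDensityOperator_state.norm_purification.le
    (R.adjoint_meas 0) (norm_pow_le_one (norm_propagator_le hH _) j)).trans ?_
  exact add_le_add hone (hzero j hj hjN)

end Fits

/-! ### The trace-norm estimate -/

section TraceNormEstimate

variable {𝓗 : Type u} [NormedAddCommGroup 𝓗] [InnerProductSpace ℂ 𝓗] [CompleteSpace 𝓗]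

theorem conjIsometry_mul_evolve {F : Type*} [NormedAddCommGroup F] [InnerProductSpace ℂ F]
    [CompleteSpace F] {H : 𝓗 →L[ℂ] 𝓗} (hH : IsSelfAdjoint H) (V : 𝓗 →ₗᵢ[ℂ] F) (M ρ : 𝓗 →L[ℂ] 𝓗)
    (t : ℝ) :
    conjIsometry V (M * evolve H ρ t) =
      (V.toContinuousLinearMap ∘L (M * propagator H t)) ∘L ρ ∘L
        adjoint (V.toContinuousLinearMap ∘L propagator H t) := by
  rw [conjIsometry, evolve_eq_comp hH, adjoint_comp]
  rfl

variable {N : ℕ} {Λ η ζ : ℝ}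

theorem NearlyCyclic.traceNorm_conjIsometry_sub_le {R : Realization 𝓗 (Fin 2)} (hN : 2 ≤ N)
    (hΛ : 0 < Λ) (hs : R.HardSupport Λ)
    (h : NearlyCyclic N R.isDensityOperator_state.purification
      (propagator R.hamiltonian (timeStep N Λ)) (R.meas 0) η ζ) (t : ℝ) (a : Fin 2) :
    traceNorm
      (conjIsometry
          (selfTestIsometry h.ne_zero (propagator R.hamiltonian (timeStep N Λ)) (R.meas 0))
          (R.meas a * evolve R.hamiltonian R.state t) -
        TensorProduct.mapL (refMeas N a * evolve (refHamiltonian N Λ) (proj (refVector N)) t)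
          (conjIsometry prodInl R.state)) ≤
      ENNReal.ofReal (4 * N * (|t| * driftRate N Λ * ζ) + 29 * N ^ 7 * (ζ + η)) := by
  have hH := R.isSelfAdjoint_hamiltonian
  have hphase : ∀ k : Fin N, ‖energyPhase N Λ t k‖ ≤ 1 := fun k => (norm_energyPhase t k).le
  have hdrift := h.dist_amp_propagator_mul_phaseProj_le hN hΛ hH hs t
  have hmeas := h.dist_amp_selfTestIsometry_comp_meas_mul_le R.sum_meas hphase hdrift a
  have hstate := h.dist_amp_selfTestIsometry_comp_le hphase hdrift
  rw [← propagator_refHamiltonian_refVector] at hmeas hstate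
  rw [conjIsometry_mul_evolve hH, mul_evolve_proj (isSelfAdjoint_refHamiltonian N Λ),
    mapL_rankOne_conjIsometry_prodInl]
  refine (R.isDensityOperator_state.traceNorm_comp_comp_adjoint_sub_le hmeas hstate).trans
    (ENNReal.ofReal_le_ofReal ((add_le_add
      (mul_le_of_le_one_right (dist_nonneg.trans hmeas) ?_)
      (mul_le_mul_of_nonneg_right (c := 2) ?_ (dist_nonneg.trans hstate))).trans_eq (by ring)))
  · refine (opNorm_comp_le _ _).trans (mul_le_one₀ ?_ (norm_nonneg _) (norm_propagator_le hH t))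
    exact LinearIsometry.norm_toContinuousLinearMap_le _
  · refine (norm_tmulInl_le _).trans ((norm_refMeas_apply_le h.ne_zero a _).trans ?_)
    rw [norm_propagator_apply (isSelfAdjoint_refHamiltonian N Λ), norm_refVector h.ne_zero, mul_one]

end TraceNormEstimate

/-! ### The constant -/

section Constant

variable {δ p q : ℝ}

theorem sqrt_sqrt_min_le_rpow (hδ : 0 ≤ δ) (hp : p ∈ Set.Icc (0 : ℝ) (1 / 4)) :
    √√(min 1 δ) ≤ δ ^ p := by
  have hmin : 0 ≤ min 1 δ := le_min zero_le_one hδ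
  calc √√(min 1 δ) = min 1 δ ^ (1 / 4 : ℝ) := by
        rw [Real.sqrt_eq_rpow, Real.sqrt_eq_rpow, ← Real.rpow_mul hmin]
        norm_num
    _ ≤ min 1 δ ^ p := Real.rpow_le_rpow_of_exponent_ge_of_imp hmin (min_le_left _ _) hp.2
        fun _ h => absurd h (by norm_num)
    _ ≤ δ ^ p := Real.rpow_le_rpow hmin (min_le_right _ _) hp.1

/-- The constant `C` of the theorem. -/
def selfTestConst (N : ℕ) (Λ : ℝ) : ℝ :=
  29 * N ^ 7 * (cycleConst N + 1) + 4 * N * (driftRate N Λ * cycleConst N) + 1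

variable {N : ℕ} {Λ : ℝ}

theorem cycleConst_nonneg (N : ℕ) : 0 ≤ cycleConst N := Real.sqrt_nonneg _

theorem selfTestConst_pos (hN : 2 ≤ N) (hΛ : 0 < Λ) : 0 < selfTestConst N Λ := by
  have := cycleConst_nonneg N
  have := driftRate_nonneg hN hΛ
  unfold selfTestConst
  positivity

theorem trace_error_le_selfTestConst_mul (hN : 2 ≤ N) (hΛ : 0 < Λ) (hδ : 0 ≤ δ)
    (hp : p ∈ Set.Icc (0 : ℝ) (1 / 4)) (hq : q ∈ Set.Icc (0 : ℝ) (1 / 4)) (t : ℝ) :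
    4 * N * (|t| * driftRate N Λ * (cycleConst N * √√(min 1 δ))) +
        29 * N ^ 7 * (cycleConst N * √√(min 1 δ) + √(min 1 δ)) ≤
      selfTestConst N Λ * δ ^ p + selfTestConst N Λ * (δ ^ q * |t|) := by
  have hc := cycleConst_nonneg N
  have hκ := driftRate_nonneg hN hΛ
  have hstatic : 29 * N ^ 7 * (cycleConst N + 1) ≤ selfTestConst N Λ := by
    rw [selfTestConst, add_assoc]
    exact le_add_of_nonneg_right (by positivity)
  have hdrift : 4 * N * (driftRate N Λ * cycleConst N) ≤ selfTestConst N Λ := by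
    rw [selfTestConst, add_right_comm]
    exact le_add_of_nonneg_left (by positivity)
  have hC := (selfTestConst_pos hN hΛ).le
  calc _ ≤ 4 * N * (|t| * driftRate N Λ * (cycleConst N * √√(min 1 δ))) +
        29 * N ^ 7 * (cycleConst N * √√(min 1 δ) + √√(min 1 δ)) := by
        gcongr
        exact Real.le_sqrt_of_sq_le
          (pow_le_of_le_one (le_min zero_le_one hδ) (min_le_left _ _) two_ne_zero)
    _ = 29 * N ^ 7 * (cycleConst N + 1) * √√(min 1 δ) +
        4 * N * (driftRate N Λ * cycleConst N) * (√√(min 1 δ) * |t|) := by ring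
    _ ≤ _ := by
        gcongr
        exacts [sqrt_sqrt_min_le_rpow hδ hp, sqrt_sqrt_min_le_rpow hδ hq]

end Constant

end SelfTest

end

theorem mainTheorem1_general (N : ℕ) (hN : 2 ≤ N) (Eplus : ℝ) (hE : 0 < Eplus) {p q : ℝ}
    (hp : p ∈ Set.Icc (0 : ℝ) (1 / 4)) (hq : q ∈ Set.Icc (0 : ℝ) (1 / 4)) :
    ∃ C : ℝ, 0 < C ∧
      ∀ (𝓗 : Type u) [NormedAddCommGroup 𝓗] [InnerProductSpace ℂ 𝓗] [CompleteSpace 𝓗]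
        (R : SelfTest.Realization 𝓗 (Fin 2)) (δ : ℝ),
        R.HardSupport Eplus → SelfTest.Fits N Eplus δ R.timeline →
        ∃ (K : Type u) (_ : NormedAddCommGroup K) (_ : InnerProductSpace ℂ K) (_ : CompleteSpace K)
          (V : 𝓗 →ₗᵢ[ℂ] EuclideanSpace ℂ (Fin N) ⊗[ℂ] K) (γ : K →L[ℂ] K),
          SelfTest.IsDensityOperator γ ∧
          ∀ (t : ℝ) (a : Fin 2),
            SelfTest.traceNorm
              (SelfTest.conjIsometry V
                  (R.meas a * SelfTest.evolve R.hamiltonian R.state t) -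
                TensorProduct.mapL
                  (SelfTest.refMeas N a *
                    SelfTest.evolve (SelfTest.refHamiltonian N Eplus)
                      (SelfTest.proj (SelfTest.refVector N)) t)
                  γ)
              ≤ ENNReal.ofReal (C * δ ^ p + C * (δ ^ q * |t|)) := by
  refine ⟨SelfTest.selfTestConst N Eplus, SelfTest.selfTestConst_pos hN hE, ?_⟩
  intro 𝓗 _ _ _ R δ hs hfit
  have hcyclic := hfit.nearlyCyclic hN hE hs
  have hδ := hfit.nonneg hcyclic.ne_zero
  refine ⟨WithLp 2 (𝓗 × 𝓗), inferInstance, inferInstance, inferInstance,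
    SelfTest.selfTestIsometry hcyclic.ne_zero
      (SelfTest.propagator R.hamiltonian (SelfTest.timeStep N Eplus)) (R.meas 0),
    SelfTest.conjIsometry SelfTest.prodInl R.state,
    R.isDensityOperator_state.conjIsometry SelfTest.prodInl, fun t a => ?_⟩
  exact (hcyclic.traceNorm_conjIsometry_sub_le hN hE hs t a).trans
    (ENNReal.ofReal_le_ofReal (SelfTest.trace_error_le_selfTestConst_mul hN hE hδ hp hq t))

theorem mainTheorem1 (N : ℕ) (hN : 2 ≤ N) (Eplus : ℝ) (hE : 0 < Eplus) :
    ∃ C : ℝ, 0 < C ∧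
      ∀ (𝓗 : Type u) [NormedAddCommGroup 𝓗] [InnerProductSpace ℂ 𝓗] [CompleteSpace 𝓗]
        (R : SelfTest.Realization 𝓗 (Fin 2)) (δ : ℝ),
        R.HardSupport Eplus → SelfTest.Fits N Eplus δ R.timeline →
        ∃ (K : Type u) (_ : NormedAddCommGroup K) (_ : InnerProductSpace ℂ K) (_ : CompleteSpace K)
          (V : 𝓗 →ₗᵢ[ℂ] EuclideanSpace ℂ (Fin N) ⊗[ℂ] K) (γ : K →L[ℂ] K),
          SelfTest.IsDensityOperator γ ∧
          ∀ (t : ℝ) (a : Fin 2),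
            SelfTest.traceNorm
              (SelfTest.conjIsometry V
                  (R.meas a * SelfTest.evolve R.hamiltonian R.state t) -
                TensorProduct.mapL
                  (SelfTest.refMeas N a *
                    SelfTest.evolve (SelfTest.refHamiltonian N Eplus)
                      (SelfTest.proj (SelfTest.refVector N)) t)
                  γ)
              ≤ ENNReal.ofReal (C * δ ^ (1 / 64 : ℝ) + C * (δ ^ (1 / 8 : ℝ) * |t|)) :=
  mainTheorem1_general N hN Eplus hE (by norm_num) (by norm_num)
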